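/- **Setting.** Let $\mathfrak m=\bigoplus_{i<0}\mathfrak g^i$ be a finite-dimensional real graded Lie algebra generated by $\mathfrak g^{-1}$, let $D$ be a smooth regular bracket-generating distribution on a smooth manifold $M$ with weak derived flag $D=D^{-1}\subset D^{-2}\subset\cdots$ (put $D^i=0$ for $i\ge 0$), and let $\mathfrak m(x)=\bigoplus_{i<0}D^i(x)/D^{i+1}(x)$ be its symbol at $x$, with the graded Lie bracket induced by the bracket of vector fields. Let $G^0$ be a Lie subgroup of the group of automorphisms of the graded Lie algebra $\mathfrak m$, and let $\mathfrak g^0$ be its Lie algebra, consisting of derivations of $\mathfrak m$; the brackets of $\mathfrak m\oplus\mathfrak g^0$ are those of $\mathfrak m$ and $\mathfrak g^0$ together with $[a,v]=-[v,a]=a(v)$ for $a\in\mathfrak g^0$, $v\in\mathfrak m$. Let $\Pi_0:P^0\to M$ be a structure of constant type $(\mathfrak m,\mathfrak g^0)$, that is, a reduction to $G^0$ of the principal bundle of all pairs $(x,\varphi)$, where $x\in M$ and $\varphi:\mathfrak m\to\mathfrak m(x)$ is an isomorphism of graded Lie algebras (with right action $(x,\varphi)\cdot A=(x,\varphi\circ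 A)$). For $\lambda=(x,\varphi)\in P^0$ put $D^i_0(\lambda)=\{Y\in T_\lambda P^0:(\Pi_0)_*Y\in D^i(x)\}$ for $i\le 0$ and $D_0^i(\lambda)=0$ for $i>0$; let $I_\lambda:\mathfrak g^0\to D^0_0(\lambda)$ be the isomorphism $X\mapsto\frac{d}{dt}(\lambda\cdot e^{tX})|_{t=0}$. For $i<0$ let $\omega^i_0:D^i_0(\lambda)\to\mathfrak g^i$, $\omega_0^i(Y)=\varphi^{-1}\big((\Pi_0)_*Y \bmod D^{i+1}(x)\big)$, and let $\bar\omega_0^i$ be the induced map on $D_0^i(\lambda)/D_0^{i+1}(\lambda)$. Fix $\lambda$. A tuple of complementary subspaces at $\lambda$ is a family $\mathcal H=\{H^i\}_{i<0}$ with $$D_0^i(\lambda)/D_0^{i+2}(\lambda)=D_0^{i+1}(\lambda)/D_0^{i+2}(\lambda)\oplus H^i\qquad(i<0).$$ Let $\mathrm{pr}^{\mathcal H}_i$ be the projection of $D_0^i(\lambda)/D_0^{i+2}(\lambda)$ onto $D_0^{i+1}(\lambda)/D_0^{i+2}(\lambda)$ along $H^i$, and for $v\in\mathfrak g^i$, $i<0$,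 let $\varphi^{\mathcal H}(v)$ be the unique element of $H^i$ whose image in $D^i(x)/D^{i+1}(x)$ under the map induced by $(\Pi_0)_*$ is $\varphi(v)$. For $v_1\in\mathfrak g^{-1}$ and $v_2\in\mathfrak g^i$, $i<0$, the structure function of $\mathcal H$ is $$C^0_{\mathcal H}(v_1,v_2)=\bar\omega_0^i\big(\mathrm{pr}^{\mathcal H}_{i-1}([Y_1,Y_2](\lambda))\big)\in\mathfrak g^i,$$ where $Y_1$, $Y_2$ are smooth vector fields near $\lambda$, sections of $D_0^{-1}$ and $D_0^i$ respectively, with $\omega_0^{-1}(Y_1)\equiv v_1$, $\omega_0^i(Y_2)\equiv v_2$, $Y_1(\lambda)=\varphi^{\mathcal H}(v_1)$ and $Y_2(\lambda)\equiv\varphi^{\mathcal H}(v_2)$ mod $D_0^{i+2}(\lambda)$. **Proposition.** For every tuple of complementary subspaces at $\lambda$ the structure function is well defined: such $Y_1$, $Y_2$ exist, $[Y_1,Y_2](\lambda)\in D_0^{i-1}(\lambda)$, and the value does not depend on their choice. If $\mathcal H$ and $\widetilde{\mathcal H}$ are two tuples of complementary subspaces at $\lambda$, then $$C^0_{\widetilde{\mathcal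 H}}=C^0_{\mathcal H}+\partial_0 f_{\mathcal H\widetilde{\mathcal H}},$$ where $f_{\mathcal H\widetilde{\mathcal H}}\in\bigoplus_{i<0}\mathrm{Hom}(\mathfrak g^i,\mathfrak g^{i+1})$ is given by $f_{\mathcal H\widetilde{\mathcal H}}(v)=\bar\omega_0^{i+1}\big(\varphi^{\widetilde{\mathcal H}}(v)-\varphi^{\mathcal H}(v)\big)$ for $v\in\mathfrak g^i$, $i<-1$, and $f_{\mathcal H\widetilde{\mathcal H}}(v)=I_\lambda^{-1}\big(\varphi^{\widetilde{\mathcal H}}(v)-\varphi^{\mathcal H}(v)\big)$ for $v\in\mathfrak g^{-1}$, and where $$\partial_0 f(v_1,v_2)=[f(v_1),v_2]+[v_1,f(v_2)]-f([v_1,v_2])\qquad(v_1\in\mathfrak g^{-1},\ v_2\in\mathfrak g^i,\ i<0),$$ with the brackets of $\mathfrak m\oplus\mathfrak g^0$. -/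

import Mathlib

open scoped Manifold ContDiff Topology
open VectorField

set_option linter.unusedSectionVars false

noncomputable section

namespace Tanaka

/-! ### Fundamental graded Lie algebras and their automorphisms -/

section Algebra

/-- A fundamental graded nilpotent Lie algebra structure `𝔪 = ⨁_{i < 0} 𝔤^i` on a (finite
dimensional) real Lie algebra `𝔪`: a grading by negative integers, compatible with the bracket, and
such that `𝔤^{-1}` generates `𝔪`. -/
structure FundamentalGrading (𝔪 : Type*) [LieRing 𝔪] [LieAlgebra ℝ 𝔪] where
  piece : ℤ → Submodule ℝ 𝔪
  isInternal : DirectSum.IsInternal piece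
  piece_eq_bot : ∀ i : ℤ, 0 ≤ i → piece i = ⊥
  lie_mem : ∀ {i j : ℤ} {v w : 𝔪}, v ∈ piece i → w ∈ piece j → ⁅v, w⁆ ∈ piece (i + j)
  generates : LieSubalgebra.lieSpan ℝ 𝔪 (piece (-1) : Set 𝔪) = ⊤

variable {𝔪 : Type*} [LieRing 𝔪] [LieAlgebra ℝ 𝔪]

/-- The group `G^0(𝔪)` of automorphisms of the graded Lie algebra `𝔪`. -/
def gradedAut (𝔤 : FundamentalGrading 𝔪) : Subgroup (𝔪 ≃ₗ[ℝ] 𝔪) where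
  carrier := {A | (∀ v w : 𝔪, A ⁅v, w⁆ = ⁅A v, A w⁆) ∧
    ∀ i : ℤ, (𝔤.piece i).map (A : 𝔪 →ₗ[ℝ] 𝔪) = 𝔤.piece i}
  one_mem' := ⟨fun _ _ => rfl, fun _ => Submodule.map_id _⟩
  mul_mem' := by
    rintro A B ⟨hA, hA'⟩ ⟨hB, hB'⟩
    refine ⟨fun v w => ?_, fun i => ?_⟩
    · simp only [LinearEquiv.mul_apply, hA, hB]
    · have : ((A * B : 𝔪 ≃ₗ[ℝ] 𝔪) : 𝔪 →ₗ[ℝ] 𝔪) = (A : 𝔪 →ₗ[ℝ] 𝔪) ∘ₗ (B : 𝔪 →ₗ[ℝ] 𝔪) := rfl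
      rw [this, Submodule.map_comp, hB', hA']
  inv_mem' := by
    rintro A ⟨hA, hA'⟩
    refine ⟨fun v w => ?_, fun i => ?_⟩
    · apply A.injective
      have h : ∀ u, A (A⁻¹ u) = u := fun u => A.apply_symm_apply u
      rw [hA, h, h, h]
    · conv_lhs => rw [← hA' i]
      rw [← Submodule.map_comp]
      have : ((A⁻¹ : 𝔪 ≃ₗ[ℝ] 𝔪) : 𝔪 →ₗ[ℝ] 𝔪) ∘ₗ (A : 𝔪 →ₗ[ℝ] 𝔪) = LinearMap.id := by
        ext v
        exact A.symm_apply_apply v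
      rw [this, Submodule.map_id]

/-- The isomorphism of `𝔤^i` with itself given by a graded automorphism. -/
def onPiece {𝔤 : FundamentalGrading 𝔪} (A : gradedAut 𝔤) (i : ℤ) :
    𝔤.piece i ≃ₗ[ℝ] 𝔤.piece i :=
  (A : 𝔪 ≃ₗ[ℝ] 𝔪).ofSubmodules _ _ (A.2.2 i)

end Algebra

/-! ### Distributions, weak derived flags and symbols -/

section Distribution

variable {E : Type*} [NormedAddCommGroup E] [NormedSpace ℝ E]
  {M : Type*} [TopologicalSpace M] [ChartedSpace E M] [IsManifold 𝓘(ℝ, E) ∞ M]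

/-- `X` is, near `x`, a smooth vector field which is tangent to the family of subspaces `F`. -/
def IsLocalSection (F : ∀ x : M, Submodule ℝ (TangentSpace 𝓘(ℝ, E) x))
    (X : ∀ x : M, TangentSpace 𝓘(ℝ, E) x) (x : M) : Prop :=
  ∃ U : Set M, IsOpen U ∧ x ∈ U ∧
    ContMDiffOn 𝓘(ℝ, E) 𝓘(ℝ, E).tangent ∞
      (fun y => (⟨y, X y⟩ : TangentBundle 𝓘(ℝ, E) M)) U ∧
    ∀ y ∈ U, X y ∈ F y

/-- The weak derived flag: `weakFlag D n` is `D^{-n}`, where `D^0 = 0`, `D^{-1} = D` and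
`D^{-n-1} = D^{-n} + [D, D^{-n}]`. -/
def weakFlag (D : ∀ x : M, Submodule ℝ (TangentSpace 𝓘(ℝ, E) x)) :
    ℕ → ∀ x : M, Submodule ℝ (TangentSpace 𝓘(ℝ, E) x)
  | 0 => fun _ => ⊥
  | 1 => D
  | n + 2 => fun x => weakFlag D (n + 1) x ⊔
      Submodule.span ℝ {w | ∃ X Y : ∀ y : M, TangentSpace 𝓘(ℝ, E) y,
        IsLocalSection D X x ∧ IsLocalSection (weakFlag D (n + 1)) Y x ∧
          w = mlieBracket 𝓘(ℝ, E) X Y x}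

/-- The term `D^i` of the weak derived flag, `i < 0` (and `D^i = 0` for `i ≥ 0`). -/
def flag (D : ∀ x : M, Submodule ℝ (TangentSpace 𝓘(ℝ, E) x)) (i : ℤ) :
    ∀ x : M, Submodule ℝ (TangentSpace 𝓘(ℝ, E) x) :=
  weakFlag D (-i).toNat

/-- `D` is a (smooth) regular bracket-generating distribution. -/
structure IsRegularDistribution (D : ∀ x : M, Submodule ℝ (TangentSpace 𝓘(ℝ, E) x)) : Prop where
  smooth : ∀ (x : M) (v : TangentSpace 𝓘(ℝ, E) x), v ∈ D x →
    ∃ X : ∀ y : M, TangentSpace 𝓘(ℝ, E) y, IsLocalSection D X x ∧ X x = v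
  regular : ∀ i : ℤ, i < 0 → ∃ r : ℕ, ∀ x : M, Module.finrank ℝ (flag D i x) = r
  bracketGenerating : ∀ x : M, ∃ i : ℤ, i < 0 ∧ flag D i x = ⊤

/-- The component `𝔤^i(x) = D^i(x) / D^{i+1}(x)` of the symbol of `D` at `x`. -/
abbrev Symbol (D : ∀ x : M, Submodule ℝ (TangentSpace 𝓘(ℝ, E) x)) (i : ℤ) (x : M) : Type _ :=
  flag D i x ⧸ (flag D (i + 1) x).submoduleOf (flag D i x)

/-- The projection `D^i(x) → 𝔤^i(x)`. -/
def symbolMk (D : ∀ x : M, Submodule ℝ (TangentSpace 𝓘(ℝ, E) x)) (i : ℤ) (x : M) :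
    flag D i x →ₗ[ℝ] Symbol D i x :=
  Submodule.mkQ _

/-- The (graph of the) Lie bracket `𝔤^i(x) × 𝔤^j(x) → 𝔤^{i+j}(x)` of the symbol of `D` at `x`:
`c = [a, b]` if `a`, `b` are represented by `Y₁ x`, `Y₂ x` for local sections `Y₁` of `D^i` and `Y₂`
of `D^j`, and `c` is represented by `[Y₁, Y₂] x`. -/
def IsSymbolBracket (D : ∀ x : M, Submodule ℝ (TangentSpace 𝓘(ℝ, E) x)) (x : M) {i j : ℤ}
    (a : Symbol D i x) (b : Symbol D j x) (c : Symbol D (i + j) x) : Prop :=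
  ∃ Y₁ Y₂ : ∀ y : M, TangentSpace 𝓘(ℝ, E) y,
    IsLocalSection (flag D i) Y₁ x ∧ IsLocalSection (flag D j) Y₂ x ∧
    (∃ h : Y₁ x ∈ flag D i x, symbolMk D i x ⟨Y₁ x, h⟩ = a) ∧
    (∃ h : Y₂ x ∈ flag D j x, symbolMk D j x ⟨Y₂ x, h⟩ = b) ∧
    ∃ h : mlieBracket 𝓘(ℝ, E) Y₁ Y₂ x ∈ flag D (i + j) x,
      symbolMk D (i + j) x ⟨mlieBracket 𝓘(ℝ, E) Y₁ Y₂ x, h⟩ = c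

variable {𝔪 : Type*} [LieRing 𝔪] [LieAlgebra ℝ 𝔪]

/-- Isomorphisms `φ : 𝔪 → 𝔪(x)` of graded Lie algebras from `𝔪` to the symbol of `D` at `x`. -/
structure SymbolIso (𝔤 : FundamentalGrading 𝔪)
    (D : ∀ x : M, Submodule ℝ (TangentSpace 𝓘(ℝ, E) x)) (x : M) where
  toEquiv : ∀ i : ℤ, 𝔤.piece i ≃ₗ[ℝ] Symbol D i x
  map_lie : ∀ (i j : ℤ), i < 0 → j < 0 → ∀ (v : 𝔤.piece i) (w : 𝔤.piece j),
    IsSymbolBracket D x (toEquiv i v) (toEquiv j w)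
      (toEquiv (i + j) ⟨⁅(v : 𝔪), (w : 𝔪)⁆, 𝔤.lie_mem v.2 w.2⟩)

/-- The composition `φ ∘ A` of `φ : 𝔪 → 𝔪(x)` with an automorphism `A` of `𝔪`. -/
def SymbolIso.comp {𝔤 : FundamentalGrading 𝔪}
    {D : ∀ x : M, Submodule ℝ (TangentSpace 𝓘(ℝ, E) x)} {x : M}
    (φ : SymbolIso 𝔤 D x) (A : gradedAut 𝔤) : SymbolIso 𝔤 D x where
  toEquiv i := (onPiece A i).trans (φ.toEquiv i)
  map_lie i j hi hj v w := by
    have h := φ.map_lie i j hi hj (onPiece A i v) (onPiece A j w)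
    have e : (onPiece A (i + j)) ⟨⁅(v : 𝔪), (w : 𝔪)⁆, 𝔤.lie_mem v.2 w.2⟩ =
        ⟨⁅((onPiece A i v : 𝔤.piece i) : 𝔪), ((onPiece A j w : 𝔤.piece j) : 𝔪)⁆,
          𝔤.lie_mem (onPiece A i v).2 (onPiece A j w).2⟩ :=
      Subtype.ext (A.2.1 v w)
    simpa only [LinearEquiv.trans_apply, e] using h

/-- The set `P^0(𝔪)` of pairs `(x, φ)`, with `φ : 𝔪 → 𝔪(x)` an isomorphism of graded Lie
algebras. -/
abbrev FullFrame (𝔤 : FundamentalGrading 𝔪)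
    (D : ∀ x : M, Submodule ℝ (TangentSpace 𝓘(ℝ, E) x)) : Type _ :=
  Σ x : M, SymbolIso 𝔤 D x

/-- The right action `(x, φ) · R_A = (x, φ ∘ A)` of `G^0(𝔪)` on `P^0(𝔪)`. -/
def FullFrame.act {𝔤 : FundamentalGrading 𝔪}
    {D : ∀ x : M, Submodule ℝ (TangentSpace 𝓘(ℝ, E) x)}
    (p : FullFrame 𝔤 D) (A : gradedAut 𝔤) : FullFrame 𝔤 D :=
  ⟨p.1, p.2.comp A⟩

end Distribution

/-! ### The structure group `G^0` and its Lie algebra `𝔤^0` -/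

section StructureGroup

variable {𝔪 : Type*} [LieRing 𝔪] [LieAlgebra ℝ 𝔪] [FiniteDimensional ℝ 𝔪]

/-- A Lie subgroup `G^0` of `G^0(𝔪)`, given as a Lie group `G` with an injective homomorphism to
`G^0(𝔪)` which is a smooth immersion (smoothness and derivatives are expressed through the matrix
coefficients `g ↦ ℓ (g v)`). -/
structure LieSubgroup (𝔤 : FundamentalGrading 𝔪)
    (F : Type*) [NormedAddCommGroup F] [NormedSpace ℝ F]
    (G : Type*) [TopologicalSpace G] [ChartedSpace F G] [Group G]
    [LieGroup 𝓘(ℝ, F) ∞ G] where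
  incl : G →* gradedAut 𝔤
  injective : Function.Injective incl
  smooth : ∀ (v : 𝔪) (ℓ : Module.Dual ℝ 𝔪),
    ContMDiff 𝓘(ℝ, F) 𝓘(ℝ, ℝ) ∞ (fun g : G => ℓ ((incl g : 𝔪 ≃ₗ[ℝ] 𝔪) v))
  immersion : ∀ X : TangentSpace 𝓘(ℝ, F) (1 : G),
    (∀ (v : 𝔪) (ℓ : Module.Dual ℝ 𝔪),
      mfderiv 𝓘(ℝ, F) 𝓘(ℝ, ℝ) (fun g : G => ℓ ((incl g : 𝔪 ≃ₗ[ℝ] 𝔪) v)) 1 X = 0) → X = 0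

variable {𝔤 : FundamentalGrading 𝔪}
  {F : Type*} [NormedAddCommGroup F] [NormedSpace ℝ F]
  {G : Type*} [TopologicalSpace G] [ChartedSpace F G] [Group G]
  [LieGroup 𝓘(ℝ, F) ∞ G]

namespace LieSubgroup

variable (ρ : LieSubgroup 𝔤 F G)

/-- The derivative at `1` of the matrix coefficient `g ↦ ℓ (g v)`. -/
def coeffDeriv (v : 𝔪) (ℓ : Module.Dual ℝ 𝔪) : TangentSpace 𝓘(ℝ, F) (1 : G) →L[ℝ] ℝ :=
  mfderiv 𝓘(ℝ, F) 𝓘(ℝ, ℝ) (fun g : G => ℓ ((ρ.incl g : 𝔪 ≃ₗ[ℝ] 𝔪) v)) 1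

lemma hasMFDerivAt_coeff (v : 𝔪) (ℓ : Module.Dual ℝ 𝔪) :
    HasMFDerivAt 𝓘(ℝ, F) 𝓘(ℝ, ℝ) (fun g : G => ℓ ((ρ.incl g : 𝔪 ≃ₗ[ℝ] 𝔪) v)) 1
      (ρ.coeffDeriv v ℓ) :=
  ((ρ.smooth v ℓ).mdifferentiableAt (by simp)).hasMFDerivAt

lemma coeffDeriv_eq (v : 𝔪) (ℓ : Module.Dual ℝ 𝔪)
    {L : TangentSpace 𝓘(ℝ, F) (1 : G) →L[ℝ] ℝ} {f : G → ℝ}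
    (h : HasMFDerivAt 𝓘(ℝ, F) 𝓘(ℝ, ℝ) f 1 L)
    (hf : f = fun g : G => ℓ ((ρ.incl g : 𝔪 ≃ₗ[ℝ] 𝔪) v)) :
    ρ.coeffDeriv v ℓ = L := by
  subst hf
  exact hasMFDerivAt_unique (ρ.hasMFDerivAt_coeff v ℓ) h

lemma coeffDeriv_add_right (v : 𝔪) (ℓ ℓ' : Module.Dual ℝ 𝔪) :
    ρ.coeffDeriv v (ℓ + ℓ') = ρ.coeffDeriv v ℓ + ρ.coeffDeriv v ℓ' :=
  ρ.coeffDeriv_eq v _ ((ρ.hasMFDerivAt_coeff v ℓ).add (ρ.hasMFDerivAt_coeff v ℓ')) rfl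

lemma coeffDeriv_smul_right (v : 𝔪) (c : ℝ) (ℓ : Module.Dual ℝ 𝔪) :
    ρ.coeffDeriv v (c • ℓ) = c • ρ.coeffDeriv v ℓ :=
  ρ.coeffDeriv_eq v _ ((ρ.hasMFDerivAt_coeff v ℓ).const_smul c) rfl

lemma coeffDeriv_add_left (v w : 𝔪) (ℓ : Module.Dual ℝ 𝔪) :
    ρ.coeffDeriv (v + w) ℓ = ρ.coeffDeriv v ℓ + ρ.coeffDeriv w ℓ :=
  ρ.coeffDeriv_eq _ _ ((ρ.hasMFDerivAt_coeff v ℓ).add (ρ.hasMFDerivAt_coeff w ℓ))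
    (by ext g; simp)

lemma coeffDeriv_smul_left (c : ℝ) (v : 𝔪) (ℓ : Module.Dual ℝ 𝔪) :
    ρ.coeffDeriv (c • v) ℓ = c • ρ.coeffDeriv v ℓ :=
  ρ.coeffDeriv_eq _ _ ((ρ.hasMFDerivAt_coeff v ℓ).const_smul c) (by ext g; simp)

/-- The endomorphism of `𝔪` defined by `X ∈ T_1 G`: the vector `diffEnd X v` is the derivative of
`g ↦ g v` at `1` in the direction `X`. -/
def diffEnd (X : TangentSpace 𝓘(ℝ, F) (1 : G)) : 𝔪 →ₗ[ℝ] 𝔪 where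
  toFun v := (Module.evalEquiv ℝ 𝔪).symm
    { toFun := fun ℓ => ρ.coeffDeriv v ℓ X
      map_add' := fun ℓ ℓ' => by rw [coeffDeriv_add_right]; rfl
      map_smul' := fun c ℓ => by rw [coeffDeriv_smul_right]; rfl }
  map_add' v w := by
    rw [← map_add]
    congr 1
    ext ℓ
    exact congrArg (fun L => L X) (ρ.coeffDeriv_add_left v w ℓ)
  map_smul' c v := by
    rw [RingHom.id_apply, ← map_smul]
    congr 1
    ext ℓ
    exact congrArg (fun L => L X) (ρ.coeffDeriv_smul_left c v ℓ)

lemma apply_diffEnd (X : TangentSpace 𝓘(ℝ, F) (1 : G)) (v : 𝔪) (ℓ : Module.Dual ℝ 𝔪) :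
    ℓ (ρ.diffEnd X v) = ρ.coeffDeriv v ℓ X := by
  simp [diffEnd]

lemma ext_dual {v w : 𝔪} (h : ∀ ℓ : Module.Dual ℝ 𝔪, ℓ v = ℓ w) : v = w :=
  (Module.evalEquiv ℝ 𝔪).injective (LinearMap.ext h)

lemma diffEnd_lie (X : TangentSpace 𝓘(ℝ, F) (1 : G)) (v w : 𝔪) :
    ρ.diffEnd X ⁅v, w⁆ = ⁅ρ.diffEnd X v, w⁆ + ⁅v, ρ.diffEnd X w⁆ := by
  refine ext_dual fun ℓ => ?_
  rw [apply_diffEnd]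
  set b := Module.finBasis ℝ 𝔪
  have key : ∀ u u' : 𝔪, ℓ ⁅u, u'⁆ =
      ∑ p : Fin (Module.finrank ℝ 𝔪) × Fin (Module.finrank ℝ 𝔪),
        ℓ ⁅b p.1, b p.2⁆ * (b.coord p.1 u * b.coord p.2 u') := by
    intro u u'
    conv_lhs => rw [← b.sum_repr u, ← b.sum_repr u']
    rw [Fintype.sum_prod_type, sum_lie_sum]
    simp only [map_sum, smul_lie, lie_smul, map_smul, smul_eq_mul, Module.Basis.coord_apply]
    refine Finset.sum_congr rfl fun i _ => Finset.sum_congr rfl fun j _ => ?_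
    ring
  have hd := HasMFDerivAt.sum (t := Finset.univ)
    (f := fun (p : Fin (Module.finrank ℝ 𝔪) × Fin (Module.finrank ℝ 𝔪)) =>
      ℓ ⁅b p.1, b p.2⁆ • ((fun g : G => b.coord p.1 ((ρ.incl g : 𝔪 ≃ₗ[ℝ] 𝔪) v)) *
        (fun g : G => b.coord p.2 ((ρ.incl g : 𝔪 ≃ₗ[ℝ] 𝔪) w))))
    (fun p _ => ((ρ.hasMFDerivAt_coeff v (b.coord p.1)).mul
      (ρ.hasMFDerivAt_coeff w (b.coord p.2))).const_smul (ℓ ⁅b p.1, b p.2⁆))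
  rw [ρ.coeffDeriv_eq _ _ hd, map_add, key, key, ← Finset.sum_add_distrib]
  · have happ : ∀ (s : Finset (Fin (Module.finrank ℝ 𝔪) × Fin (Module.finrank ℝ 𝔪)))
        (L : Fin (Module.finrank ℝ 𝔪) × Fin (Module.finrank ℝ 𝔪) →
          (TangentSpace 𝓘(ℝ, F) (1 : G) →L[ℝ] ℝ)), (∑ p ∈ s, L p) X = ∑ p ∈ s, L p X :=
      fun s L => by simp
    refine (happ _ _).trans (Finset.sum_congr rfl fun p _ => ?_)
    rw [apply_diffEnd, apply_diffEnd]
    change ℓ ⁅b p.1, b p.2⁆ * (b.coord p.1 ((ρ.incl 1 : 𝔪 ≃ₗ[ℝ] 𝔪) v) *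
      ρ.coeffDeriv w (b.coord p.2) X + b.coord p.2 ((ρ.incl 1 : 𝔪 ≃ₗ[ℝ] 𝔪) w) *
      ρ.coeffDeriv v (b.coord p.1) X) = _
    rw [map_one]
    simp only [Subgroup.coe_one, LinearEquiv.coe_one, id]
    ring
  · ext g
    rw [(ρ.incl g).2.1 v w, key]
    simp

/-- The identification of `T_1 G` with the Lie algebra `𝔤^0` of `G^0`, consisting of derivations of
`𝔪`. -/
def toDer : TangentSpace 𝓘(ℝ, F) (1 : G) →ₗ[ℝ] LieDerivation ℝ 𝔪 𝔪 where
  toFun X :=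
    { ρ.diffEnd X with
      leibniz' := by
        intro v w
        change ρ.diffEnd X ⁅v, w⁆ = ⁅v, ρ.diffEnd X w⁆ - ⁅w, ρ.diffEnd X v⁆
        rw [diffEnd_lie, ← lie_skew w, sub_neg_eq_add, add_comm] }
  map_add' X Y := by
    ext v
    refine ext_dual fun ℓ => ?_
    change ℓ (ρ.diffEnd (X + Y) v) = ℓ (ρ.diffEnd X v + ρ.diffEnd Y v)
    rw [map_add, apply_diffEnd, apply_diffEnd, apply_diffEnd, map_add]
  map_smul' c X := by
    ext v
    refine ext_dual fun ℓ => ?_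
    change ℓ (ρ.diffEnd (c • X) v) = ℓ (c • ρ.diffEnd X v)
    rw [map_smul, apply_diffEnd, apply_diffEnd, map_smul]

end LieSubgroup

/-- The Lie algebra `𝔪 ⊕ Der 𝔪` with `[a, v] = a v` for `a ∈ Der 𝔪`, `v ∈ 𝔪`. It contains the
graded Lie algebra `𝔪 ⊕ 𝔤^0` as the subalgebra spanned by the subspaces `extPiece`. -/
abbrev ExtAlgebra (𝔪 : Type*) [LieRing 𝔪] [LieAlgebra ℝ 𝔪] : Type _ :=
  LieAlgebra.SemiDirectSum 𝔪 (LieDerivation ℝ 𝔪 𝔪)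
    (LieHom.id : LieDerivation ℝ 𝔪 𝔪 →ₗ⁅ℝ⁆ LieDerivation ℝ 𝔪 𝔪)

/-- The inclusion `𝔪 → 𝔪 ⊕ Der 𝔪`. -/
def inM : 𝔪 →ₗ[ℝ] ExtAlgebra 𝔪 := (LieAlgebra.SemiDirectSum.inl _ : 𝔪 →ₗ⁅ℝ⁆ ExtAlgebra 𝔪)

/-- The inclusion `Der 𝔪 → 𝔪 ⊕ Der 𝔪`. -/
def inDer : LieDerivation ℝ 𝔪 𝔪 →ₗ[ℝ] ExtAlgebra 𝔪 :=
  (LieAlgebra.SemiDirectSum.inr _ : LieDerivation ℝ 𝔪 𝔪 →ₗ⁅ℝ⁆ ExtAlgebra 𝔪)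

/-- The component of degree `j` of the graded Lie algebra `𝔪 ⊕ 𝔤^0`. -/
def extPiece (ρ : LieSubgroup 𝔤 F G) (j : ℤ) : Submodule ℝ (ExtAlgebra 𝔪) :=
  if j = 0 then LinearMap.range (inDer ∘ₗ ρ.toDer) else (𝔤.piece j).map inM

/-- The space `⨁_{i < 0} Hom(𝔤^i, 𝔤^{i+1})`. -/
abbrev DegreeOneHom (ρ : LieSubgroup 𝔤 F G) : Type _ :=
  ∀ i : ℤ, i < 0 → (𝔤.piece i →ₗ[ℝ] extPiece ρ (i + 1))

/-- The generalized Spencer operator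
`∂₀ f (v₁, v₂) = [f v₁, v₂] + [v₁, f v₂] - f [v₁, v₂]`, for `v₁ ∈ 𝔤^{-1}`, `v₂ ∈ 𝔤^i`, `i < 0`, the
brackets being those of `𝔪 ⊕ 𝔤^0`. -/
def spencer (ρ : LieSubgroup 𝔤 F G) (f : DegreeOneHom ρ) (i : ℤ) (hi : i < 0)
    (v₁ : 𝔤.piece (-1)) (v₂ : 𝔤.piece i) : ExtAlgebra 𝔪 :=
  ⁅(f (-1) (by decide) v₁ : ExtAlgebra 𝔪), inM (v₂ : 𝔪)⁆ +
    ⁅inM (v₁ : 𝔪), (f i hi v₂ : ExtAlgebra 𝔪)⁆ -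
    (f (-1 + i) (by omega) ⟨⁅(v₁ : 𝔪), (v₂ : 𝔪)⁆, 𝔤.lie_mem v₁.2 v₂.2⟩ : ExtAlgebra 𝔪)

end StructureGroup

/-! ### Structures of constant type `(𝔪, 𝔤^0)` -/

section Structures

variable {𝔪 : Type*} [LieRing 𝔪] [LieAlgebra ℝ 𝔪] [FiniteDimensional ℝ 𝔪]
  {𝔤 : FundamentalGrading 𝔪}
  {E : Type*} [NormedAddCommGroup E] [NormedSpace ℝ E]
  {M : Type*} [TopologicalSpace M] [ChartedSpace E M] [IsManifold 𝓘(ℝ, E) ∞ M]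
  {D : ∀ x : M, Submodule ℝ (TangentSpace 𝓘(ℝ, E) x)}
  {F : Type*} [NormedAddCommGroup F] [NormedSpace ℝ F]
  {G : Type*} [TopologicalSpace G] [ChartedSpace F G] [Group G] [LieGroup 𝓘(ℝ, F) ∞ G]
  {ρ : LieSubgroup 𝔤 F G}
  {E' : Type*} [NormedAddCommGroup E'] [NormedSpace ℝ E']
  {P : Type*} [TopologicalSpace P] [ChartedSpace E' P] [IsManifold 𝓘(ℝ, E') ∞ P]

/-- A structure of constant type `(𝔪, 𝔤^0)`: a smooth principal `G^0`-bundle `P` over `M`, together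
with a smooth `G^0`-equivariant map `P → P^0(𝔪)`, `λ ↦ (x, φ)`, over the identity of `M`. (This map is
automatically injective; `P` is identified with its image.) -/
structure ConstantTypeStructure (D : ∀ x : M, Submodule ℝ (TangentSpace 𝓘(ℝ, E) x))
    (ρ : LieSubgroup 𝔤 F G)
    (E' : Type*) [NormedAddCommGroup E'] [NormedSpace ℝ E']
    (P : Type*) [TopologicalSpace P] [ChartedSpace E' P] [IsManifold 𝓘(ℝ, E') ∞ P] where
  /-- the pair `(x, φ)` which corresponds to a point of `P` -/
  toFrame : P → FullFrame 𝔤 D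
  /-- the right action of the structure group -/
  act : P → G → P
  act_one : ∀ p : P, act p 1 = p
  act_mul : ∀ (p : P) (g h : G), act p (g * h) = act (act p g) h
  toFrame_act : ∀ (p : P) (g : G), toFrame (act p g) = (toFrame p).act (ρ.incl g)
  smooth_proj : ContMDiff 𝓘(ℝ, E') 𝓘(ℝ, E) ∞ (fun p => (toFrame p).1)
  smooth_act : ContMDiff (𝓘(ℝ, E').prod 𝓘(ℝ, F)) 𝓘(ℝ, E') ∞ (fun q : P × G => act q.1 q.2)
  /-- `φ v ∈ D^i(x) / D^{i+1}(x)` depends smoothly on `(x, φ) ∈ P`, for every `v ∈ 𝔤^i` -/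
  smooth_frame : ∀ (p : P) (i : ℤ) (v : 𝔤.piece i), i < 0 →
    ∃ (U : Set P) (W : ∀ q : P, TangentSpace 𝓘(ℝ, E) (toFrame q).1), IsOpen U ∧ p ∈ U ∧
      ContMDiffOn 𝓘(ℝ, E') 𝓘(ℝ, E).tangent ∞
        (fun q => (⟨(toFrame q).1, W q⟩ : TangentBundle 𝓘(ℝ, E) M)) U ∧
      ∀ q ∈ U, ∃ h : W q ∈ flag D i (toFrame q).1,
        symbolMk D i (toFrame q).1 ⟨W q, h⟩ = (toFrame q).2.toEquiv i v
  /-- equivariant smooth local trivializations -/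
  localTriv : ∀ x : M, ∃ (U : Set M) (e : OpenPartialHomeomorph (M × G) P), IsOpen U ∧ x ∈ U ∧
    e.source = U ×ˢ Set.univ ∧ e.target = {p | (toFrame p).1 ∈ U} ∧
    ContMDiffOn (𝓘(ℝ, E).prod 𝓘(ℝ, F)) 𝓘(ℝ, E') ∞ e e.source ∧
    ContMDiffOn 𝓘(ℝ, E') (𝓘(ℝ, E).prod 𝓘(ℝ, F)) ∞ e.symm e.target ∧
    ∀ y ∈ U, ∀ g : G, (toFrame (e (y, g))).1 = y ∧ ∀ h : G, e (y, g * h) = act (e (y, g)) h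

namespace ConstantTypeStructure

variable (S : ConstantTypeStructure D ρ E' P)

/-- The projection `Π₀ : P^0 → M`. -/
def proj (p : P) : M := (S.toFrame p).1

/-- The isomorphism `φ : 𝔪 → 𝔪(x)`, where `p = (x, φ)`. -/
def frame (p : P) : SymbolIso 𝔤 D (S.proj p) := (S.toFrame p).2

/-- The differential of the projection. -/
def dproj (p : P) : TangentSpace 𝓘(ℝ, E') p →ₗ[ℝ] TangentSpace 𝓘(ℝ, E) (S.proj p) :=
  (mfderiv 𝓘(ℝ, E') 𝓘(ℝ, E) S.proj p).toLinearMap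

/-- The filtration `D₀^i` of the tangent bundle of `P^0`: the preimage of `D^i` under the differential
of the projection for `i < 0`, the vertical subspace for `i = 0`, and `0` for `i > 0`. -/
def filt (i : ℤ) (p : P) : Submodule ℝ (TangentSpace 𝓘(ℝ, E') p) :=
  if i ≤ 0 then (flag D i (S.proj p)).comap (S.dproj p) else ⊥

/-- `I_λ : 𝔤^0 → T_λ P^0`, `X ↦ d/dt (λ · g_t)` at `t = 0`, for a curve `g_t` in `G` through `1` with
velocity `X`. -/
def vert (p : P) : TangentSpace 𝓘(ℝ, F) (1 : G) →ₗ[ℝ] TangentSpace 𝓘(ℝ, E') p :=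
  (mfderiv 𝓘(ℝ, F) 𝓘(ℝ, E') (fun g : G => S.act p g) 1).toLinearMap

lemma weakFlag_le_succ (D : ∀ x : M, Submodule ℝ (TangentSpace 𝓘(ℝ, E) x)) (n : ℕ) (x : M) :
    weakFlag D n x ≤ weakFlag D (n + 1) x := by
  rcases n with _ | n
  · exact bot_le
  · exact le_sup_left

lemma flag_succ_le (D : ∀ x : M, Submodule ℝ (TangentSpace 𝓘(ℝ, E) x)) (i : ℤ) (x : M) :
    flag D (i + 1) x ≤ flag D i x := by
  rcases lt_or_ge i 0 with hi | hi
  · have h : (-i).toNat = (-(i + 1)).toNat + 1 := by omega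
    unfold flag
    rw [h]
    exact weakFlag_le_succ D _ x
  · have h : (-i).toNat = (-(i + 1)).toNat := by omega
    unfold flag
    rw [h]

lemma filt_succ_le (i : ℤ) (p : P) : S.filt (i + 1) p ≤ S.filt i p := by
  unfold filt
  split_ifs with h1 h2
  · exact Submodule.comap_mono (flag_succ_le D i _)
  · omega
  · exact bot_le
  · exact le_rfl

lemma dproj_mem {i : ℤ} {p : P} {v : TangentSpace 𝓘(ℝ, E') p} (hv : v ∈ S.filt i p) :
    S.dproj p v ∈ flag D i (S.proj p) := by
  unfold filt at hv
  split_ifs at hv with h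
  · exact hv
  · rw [Submodule.mem_bot] at hv
    rw [hv, map_zero]
    exact Submodule.zero_mem _

lemma mdifferentiableAt_proj (p : P) : MDifferentiableAt 𝓘(ℝ, E') 𝓘(ℝ, E) S.proj p :=
  S.smooth_proj.mdifferentiableAt (by simp)

lemma mdifferentiableAt_act (p : P) (g : G) :
    MDifferentiableAt 𝓘(ℝ, F) 𝓘(ℝ, E') (fun g : G => S.act p g) g :=
  (S.smooth_act.comp (contMDiff_const.prodMk contMDiff_id)).mdifferentiableAt (by simp)

/-- A smooth local section of the projection through a given point. -/
lemma exists_section (p : P) : ∃ (s : M → P) (r : P → G),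
    MDifferentiableAt 𝓘(ℝ, E) 𝓘(ℝ, E') s (S.proj p) ∧ MDifferentiableAt 𝓘(ℝ, E') 𝓘(ℝ, F) r p ∧
    s (S.proj p) = p ∧ (∀ᶠ y in 𝓝 (S.proj p), S.proj (s y) = y) ∧
    (∀ g : G, r (S.act p g) = g) ∧ ∀ᶠ q in 𝓝 p, S.act (s (S.proj q)) (r q) = q := by
  obtain ⟨U, e, hU, hpU, hs, ht, hes, het, he⟩ := S.localTriv (S.proj p)
  have hp : p ∈ e.target := by rw [ht]; exact hpU
  have hq0 := e.map_target hp
  rw [hs] at hq0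
  have hpe : e (e.symm p) = p := e.right_inv hp
  set g₀ := (e.symm p).2 with hg₀
  have h1 : (e.symm p).1 = S.proj p := by
    have h := (he (e.symm p).1 hq0.1 (e.symm p).2).1
    have h' : (S.toFrame (e (e.symm p))).1 = (e.symm p).1 := h
    rw [hpe] at h'
    exact h'.symm
  have hpe' : e (S.proj p, g₀) = p := by rw [← h1]; exact hpe
  have hact : ∀ y ∈ U, ∀ g : G, S.act (e (y, g₀)) (g₀⁻¹ * g) = e (y, g) := by
    intro y hy g
    rw [← (he y hy g₀).2 (g₀⁻¹ * g), mul_inv_cancel_left]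
  refine ⟨fun y => e (y, g₀), fun q => g₀⁻¹ * (e.symm q).2, ?_, ?_, hpe', ?_, ?_, ?_⟩
  · have h2 : ContMDiffAt (𝓘(ℝ, E).prod 𝓘(ℝ, F)) 𝓘(ℝ, E') ∞ e (S.proj p, g₀) :=
      hes.contMDiffAt (e.open_source.mem_nhds (by rw [hs]; exact ⟨hpU, trivial⟩))
    exact (h2.mdifferentiableAt (by simp)).comp (S.proj p)
      (mdifferentiableAt_id.prodMk mdifferentiableAt_const)
  · have h2 : ContMDiffAt 𝓘(ℝ, E') (𝓘(ℝ, E).prod 𝓘(ℝ, F)) ∞ e.symm p :=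
      het.contMDiffAt (e.open_target.mem_nhds hp)
    have h3 : ContMDiffAt 𝓘(ℝ, E') 𝓘(ℝ, F) ∞ (fun q => g₀⁻¹ * (e.symm q).2) p :=
      (contMDiff_mul_left (I := 𝓘(ℝ, F)) (n := ∞) (a := g₀⁻¹)).contMDiffAt.comp p
        (contMDiffAt_snd.comp p h2)
    exact h3.mdifferentiableAt (by simp)
  · filter_upwards [hU.mem_nhds hpU] with y hy
    exact (he y hy g₀).1
  · intro g
    have h2 : S.act p g = e (S.proj p, g₀ * g) := by
      rw [(he _ hpU g₀).2 g, hpe']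
    have h3 : (S.proj p, g₀ * g) ∈ e.source := by rw [hs]; exact ⟨hpU, trivial⟩
    simp only [h2, e.left_inv h3, inv_mul_cancel_left]
  · filter_upwards [e.open_target.mem_nhds hp] with q hq
    have hqs := e.map_target hq
    rw [hs] at hqs
    have h4 : S.proj q = (e.symm q).1 := by
      have h := (he (e.symm q).1 hqs.1 (e.symm q).2).1
      have h' : (S.toFrame (e (e.symm q))).1 = (e.symm q).1 := h
      rw [e.right_inv hq] at h'
      exact h'
    change S.act (e (S.proj q, g₀)) (g₀⁻¹ * (e.symm q).2) = q
    rw [h4, hact _ hqs.1]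
    exact e.right_inv hq

lemma dproj_surjective (p : P) : Function.Surjective (S.dproj p) := by
  obtain ⟨s, r, hs, -, hsp, hproj, -, -⟩ := S.exists_section p
  intro v
  have h1 : HasMFDerivAt 𝓘(ℝ, E) 𝓘(ℝ, E) (S.proj ∘ s) (S.proj p)
      ((mfderiv 𝓘(ℝ, E') 𝓘(ℝ, E) S.proj (s (S.proj p))).comp
        (mfderiv 𝓘(ℝ, E) 𝓘(ℝ, E') s (S.proj p))) :=
    (S.mdifferentiableAt_proj _).hasMFDerivAt.comp _ hs.hasMFDerivAt
  have h2 : HasMFDerivAt 𝓘(ℝ, E) 𝓘(ℝ, E) (S.proj ∘ s) (S.proj p)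
      (ContinuousLinearMap.id ℝ (TangentSpace 𝓘(ℝ, E) (S.proj p))) :=
    (hasMFDerivAt_id (S.proj p)).congr_of_eventuallyEq hproj
  have h3 := hasMFDerivAt_unique h1 h2
  rw [hsp] at h3
  exact ⟨_, congrArg (fun L => L v) h3⟩

lemma vert_injective (p : P) : Function.Injective (S.vert p) := by
  obtain ⟨s, r, -, hr, -, -, hra, -⟩ := S.exists_section p
  have hp : S.act p 1 = p := S.act_one p
  rw [← hp] at hr
  have h1 : HasMFDerivAt 𝓘(ℝ, F) 𝓘(ℝ, F) (r ∘ fun g => S.act p g) 1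
      ((mfderiv 𝓘(ℝ, E') 𝓘(ℝ, F) r (S.act p 1)).comp
        (mfderiv 𝓘(ℝ, F) 𝓘(ℝ, E') (fun g => S.act p g) 1)) :=
    HasMFDerivAt.comp (1 : G) hr.hasMFDerivAt (S.mdifferentiableAt_act p 1).hasMFDerivAt
  have h2 : (r ∘ fun g => S.act p g) = id := funext hra
  rw [h2] at h1
  have h3 := hasMFDerivAt_unique h1 (hasMFDerivAt_id (1 : G))
  intro X Y hXY
  have hX := congrArg (fun L => L X) h3
  have hY := congrArg (fun L => L Y) h3
  refine hX.symm.trans (Eq.trans ?_ hY)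
  exact congrArg (mfderiv 𝓘(ℝ, E') 𝓘(ℝ, F) r (S.act p 1)) hXY

lemma range_vert (p : P) : LinearMap.range (S.vert p) = LinearMap.ker (S.dproj p) := by
  apply le_antisymm
  · rintro _ ⟨X, rfl⟩
    rw [LinearMap.mem_ker]
    have h1 : HasMFDerivAt 𝓘(ℝ, F) 𝓘(ℝ, E) (S.proj ∘ fun g => S.act p g) 1
        ((mfderiv 𝓘(ℝ, E') 𝓘(ℝ, E) S.proj (S.act p 1)).comp
          (mfderiv 𝓘(ℝ, F) 𝓘(ℝ, E') (fun g => S.act p g) 1)) :=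
      HasMFDerivAt.comp (1 : G) (S.mdifferentiableAt_proj _).hasMFDerivAt
        (S.mdifferentiableAt_act p 1).hasMFDerivAt
    have h2 : (S.proj ∘ fun g => S.act p g) = fun _ : G => S.proj p := by
      funext g
      have h := congrArg Sigma.fst (S.toFrame_act p g)
      exact h
    rw [h2, S.act_one] at h1
    have h3 := hasMFDerivAt_unique h1 (hasMFDerivAt_const (S.proj p) (1 : G))
    exact congrArg (fun L => L X) h3
  · intro v hv
    rw [LinearMap.mem_ker] at hv
    obtain ⟨s, r, hs, hr, hsp, -, hra, hsr⟩ := S.exists_section p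
    have hrp : r p = 1 := by
      have := hra 1
      rwa [S.act_one] at this
    have hF : MDifferentiableAt (𝓘(ℝ, E').prod 𝓘(ℝ, F)) 𝓘(ℝ, E')
        (fun q : P × G => S.act q.1 q.2) (s (S.proj p), r p) :=
      S.smooth_act.mdifferentiableAt (by simp)
    have hsP : HasMFDerivAt 𝓘(ℝ, E') 𝓘(ℝ, E') (s ∘ S.proj) p
        ((mfderiv 𝓘(ℝ, E) 𝓘(ℝ, E') s (S.proj p)).comp
          (mfderiv 𝓘(ℝ, E') 𝓘(ℝ, E) S.proj p)) :=
      HasMFDerivAt.comp p hs.hasMFDerivAt (S.mdifferentiableAt_proj p).hasMFDerivAt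
    have hpair := hsP.prodMk hr.hasMFDerivAt
    have h1 := HasMFDerivAt.comp p hF.hasMFDerivAt hpair
    have h2 : HasMFDerivAt 𝓘(ℝ, E') 𝓘(ℝ, E')
        ((fun q : P × G => S.act q.1 q.2) ∘ fun q => ((s ∘ S.proj) q, r q)) p
        (ContinuousLinearMap.id ℝ (TangentSpace 𝓘(ℝ, E') p)) :=
      (hasMFDerivAt_id p).congr_of_eventuallyEq hsr
    have h3 := congrArg (fun L => L v) (hasMFDerivAt_unique h1 h2)
    have h4 : mfderiv (𝓘(ℝ, E').prod 𝓘(ℝ, F)) 𝓘(ℝ, E')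
        (fun q : P × G => S.act q.1 q.2) (s (S.proj p), r p)
        (mfderiv 𝓘(ℝ, E) 𝓘(ℝ, E') s (S.proj p) (mfderiv 𝓘(ℝ, E') 𝓘(ℝ, E) S.proj p v),
          mfderiv 𝓘(ℝ, E') 𝓘(ℝ, F) r p v) = v := h3
    let w : TangentSpace (𝓘(ℝ, E').prod 𝓘(ℝ, F)) (s (S.proj p), r p) :=
      (mfderiv 𝓘(ℝ, E) 𝓘(ℝ, E') s (S.proj p) (mfderiv 𝓘(ℝ, E') 𝓘(ℝ, E) S.proj p v),
          mfderiv 𝓘(ℝ, E') 𝓘(ℝ, F) r p v)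
    have h5 := mfderiv_prod_eq_add_apply (I := 𝓘(ℝ, E')) (I' := 𝓘(ℝ, F)) (I'' := 𝓘(ℝ, E'))
      (f := fun q : P × G => S.act q.1 q.2) (p := (s (S.proj p), r p)) (v := w) hF
    have h6 : mfderiv 𝓘(ℝ, E') 𝓘(ℝ, E) S.proj p v = 0 := hv
    have h7 := h5.symm.trans h4
    simp only [w, h6] at h7
    rw [hsp, hrp] at h7
    refine ⟨mfderiv 𝓘(ℝ, E') 𝓘(ℝ, F) r p v, ?_⟩
    refine Eq.trans ?_ h7
    refine (Eq.trans (congrArg (· + _) ?_) (zero_add _)).symm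
    exact (congrArg _ (ContinuousLinearMap.map_zero (mfderiv 𝓘(ℝ, E) 𝓘(ℝ, E') s (S.proj p)))).trans
      (ContinuousLinearMap.map_zero (mfderiv 𝓘(ℝ, E') 𝓘(ℝ, E') (fun z => S.act z 1) p))

/-! #### The soldering form -/

/-- The quotient `D₀^i(λ) / D₀^{i+1}(λ)`. -/
abbrev Gr (i : ℤ) (p : P) : Type _ :=
  S.filt i p ⧸ (S.filt (i + 1) p).submoduleOf (S.filt i p)

/-- The quotient `D₀^i(λ) / D₀^{i+2}(λ)`. -/
abbrev GrTwo (i : ℤ) (p : P) : Type _ :=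
  S.filt i p ⧸ (S.filt (i + 1 + 1) p).submoduleOf (S.filt i p)

/-- The projection `D₀^i(λ) → D₀^i(λ) / D₀^{i+2}(λ)`. -/
def mkTwo (i : ℤ) (p : P) : S.filt i p →ₗ[ℝ] S.GrTwo i p := Submodule.mkQ _

/-- The map `D₀^i(λ) → D^i(x) / D^{i+1}(x)`, `Y ↦ (Π₀_* Y)_i`. -/
def toSymbol (i : ℤ) (p : P) : S.filt i p →ₗ[ℝ] Symbol D i (S.proj p) :=
  symbolMk D i (S.proj p) ∘ₗ (S.dproj p).restrict fun _ hv => S.dproj_mem hv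

lemma toSymbol_eq_zero {i : ℤ} {p : P} {v : S.filt i p}
    (hv : (v : TangentSpace 𝓘(ℝ, E') p) ∈ S.filt (i + 1) p) : S.toSymbol i p v = 0 :=
  (Submodule.Quotient.mk_eq_zero _).2 (S.dproj_mem hv)

lemma mem_of_toSymbol_eq_zero {i : ℤ} (hi : i < 0) {p : P} {v : S.filt i p}
    (hv : S.toSymbol i p v = 0) : (v : TangentSpace 𝓘(ℝ, E') p) ∈ S.filt (i + 1) p := by
  have h : S.dproj p v ∈ flag D (i + 1) (S.proj p) := by
    have h' : (S.dproj p).restrict (fun _ hv => S.dproj_mem hv) v ∈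
        LinearMap.ker (symbolMk D i (S.proj p)) := hv
    rw [symbolMk, Submodule.ker_mkQ] at h'
    exact h'
  unfold filt
  rw [if_pos (by omega)]
  exact h

lemma toSymbol_surjective {i : ℤ} (hi : i < 0) (p : P) :
    Function.Surjective (S.toSymbol i p) := by
  intro a
  obtain ⟨⟨w, hw⟩, rfl⟩ := Submodule.mkQ_surjective _ a
  obtain ⟨v, rfl⟩ := S.dproj_surjective p w
  refine ⟨⟨v, ?_⟩, rfl⟩
  unfold filt
  rw [if_pos (by omega)]
  exact hw

/-- The soldering form `ω₀^i : D₀^i(λ) → 𝔤^i`, `ω₀^i(Y) = φ^{-1}((Π₀_* Y)_i)`. -/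
def solder (i : ℤ) (p : P) : S.filt i p →ₗ[ℝ] 𝔤.piece i :=
  ((S.frame p).toEquiv i).symm.toLinearMap ∘ₗ S.toSymbol i p

/-- The form `D₀^i(λ) / D₀^{i+1}(λ) → 𝔤^i` induced by the soldering form. -/
def solderBar (i : ℤ) (p : P) : S.Gr i p →ₗ[ℝ] 𝔤.piece i :=
  Submodule.liftQ _ (S.solder i p) fun v hv => by
    rw [LinearMap.mem_ker]
    have h : S.toSymbol i p v = 0 := S.toSymbol_eq_zero hv
    simp [solder, h]

/-- The map `Π₀^i ∘ π₀^i : D₀^i(λ) / D₀^{i+2}(λ) → D^i(x) / D^{i+1}(x)`. -/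
def twoToSymbol (i : ℤ) (p : P) : S.GrTwo i p →ₗ[ℝ] Symbol D i (S.proj p) :=
  Submodule.liftQ _ (S.toSymbol i p) fun _ hv =>
    S.toSymbol_eq_zero (S.filt_succ_le (i + 1) p hv)

/-- The inclusion `D₀^{i+1}(λ) / D₀^{i+2}(λ) → D₀^i(λ) / D₀^{i+2}(λ)`. -/
def grIncl (i : ℤ) (p : P) : S.Gr (i + 1) p →ₗ[ℝ] S.GrTwo i p :=
  Submodule.mapQ _ _ (Submodule.inclusion (S.filt_succ_le i p)) fun _ hv => hv

lemma grIncl_injective (i : ℤ) (p : P) : Function.Injective (S.grIncl i p) := by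
  rw [injective_iff_map_eq_zero]
  intro a ha
  obtain ⟨v, rfl⟩ := Submodule.mkQ_surjective _ a
  exact (Submodule.Quotient.mk_eq_zero _).2 ((Submodule.Quotient.mk_eq_zero _).1 ha :)

lemma ker_twoToSymbol {i : ℤ} (hi : i < 0) (p : P) :
    LinearMap.ker (S.twoToSymbol i p) = LinearMap.range (S.grIncl i p) := by
  ext a
  constructor
  · intro ha
    obtain ⟨v, rfl⟩ := Submodule.mkQ_surjective _ a
    have h : (v : TangentSpace 𝓘(ℝ, E') p) ∈ S.filt (i + 1) p :=
      S.mem_of_toSymbol_eq_zero hi ha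
    exact ⟨Submodule.mkQ _ ⟨v, h⟩, rfl⟩
  · rintro ⟨b, rfl⟩
    obtain ⟨v, rfl⟩ := Submodule.mkQ_surjective _ b
    exact S.toSymbol_eq_zero (v := Submodule.inclusion (S.filt_succ_le i p) v) v.2

lemma twoToSymbol_surjective {i : ℤ} (hi : i < 0) (p : P) :
    Function.Surjective (S.twoToSymbol i p) := by
  intro a
  obtain ⟨v, rfl⟩ := S.toSymbol_surjective hi p a
  exact ⟨Submodule.mkQ _ v, rfl⟩

/-! #### Tuples of complementary subspaces and their structure functions -/

/-- A tuple `ℋ = {H^i}_{i < 0}` of subspaces at `λ`, with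
`D₀^i(λ) / D₀^{i+2}(λ) = D₀^{i+1}(λ) / D₀^{i+2}(λ) ⊕ H^i`. -/
structure ComplTuple (p : P) where
  space : ∀ i : ℤ, i < 0 → Submodule ℝ (S.GrTwo i p)
  isCompl : ∀ (i : ℤ) (hi : i < 0), IsCompl (LinearMap.range (S.grIncl i p)) (space i hi)

variable {S}
variable {p : P}

namespace ComplTuple

lemma bijective (H : S.ComplTuple p) (i : ℤ) (hi : i < 0) :
    Function.Bijective ((S.twoToSymbol i p).domRestrict (H.space i hi)) := by
  constructor
  · rw [injective_iff_map_eq_zero]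
    rintro ⟨a, ha⟩ h
    have h1 : a ∈ LinearMap.ker (S.twoToSymbol i p) := h
    rw [S.ker_twoToSymbol hi] at h1
    exact Subtype.ext ((Submodule.disjoint_def.1 (H.isCompl i hi).disjoint) a h1 ha)
  · intro a
    obtain ⟨b, rfl⟩ := S.twoToSymbol_surjective hi p a
    have hb : b ∈ LinearMap.range (S.grIncl i p) ⊔ H.space i hi := by
      rw [(H.isCompl i hi).sup_eq_top]
      trivial
    obtain ⟨c, hc, d, hd, rfl⟩ := Submodule.mem_sup.1 hb
    rw [← S.ker_twoToSymbol hi, LinearMap.mem_ker] at hc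
    refine ⟨⟨d, hd⟩, ?_⟩
    rw [map_add, hc, zero_add]
    rfl

/-- The restriction of `φ^ℋ` to `𝔤^i`, `i < 0`: the composition of `φ` with the inverse of
`Π₀^i ∘ π₀^i` restricted to `H^i`. -/
def lift (H : S.ComplTuple p) (i : ℤ) (hi : i < 0) : 𝔤.piece i →ₗ[ℝ] S.GrTwo i p :=
  (H.space i hi).subtype ∘ₗ (LinearEquiv.ofBijective _ (H.bijective i hi)).symm.toLinearMap ∘ₗ
    ((S.frame p).toEquiv i).toLinearMap

lemma twoToSymbol_lift (H : S.ComplTuple p) (i : ℤ) (hi : i < 0) (v : 𝔤.piece i) :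
    S.twoToSymbol i p (H.lift i hi v) = (S.frame p).toEquiv i v :=
  (LinearEquiv.ofBijective _ (H.bijective i hi)).apply_symm_apply ((S.frame p).toEquiv i v)

/-- The projection `pr_i^ℋ` of `D₀^i(λ) / D₀^{i+2}(λ)` onto `D₀^{i+1}(λ) / D₀^{i+2}(λ)` parallel to
`H^i`. -/
def pr (H : S.ComplTuple p) (i : ℤ) (hi : i < 0) : S.GrTwo i p →ₗ[ℝ] S.Gr (i + 1) p :=
  LinearMap.linearProjOfIsCompl (H.space i hi) (S.grIncl i p) (S.grIncl_injective i p)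
    (H.isCompl i hi)

/-- `Y` is, near `λ`, a smooth section of `D₀^i` with `ω₀^i(Y) ≡ v`, and `Y(λ) ≡ φ^ℋ(v)` modulo
`D₀^{i+2}(λ)` (note that `D₀^{i+2}(λ) = 0` for `i = -1`). -/
def IsAdapted (H : S.ComplTuple p) (i : ℤ) (hi : i < 0) (v : 𝔤.piece i)
    (Y : ∀ q : P, TangentSpace 𝓘(ℝ, E') q) : Prop :=
  (∃ U : Set P, IsOpen U ∧ p ∈ U ∧
    ContMDiffOn 𝓘(ℝ, E') 𝓘(ℝ, E').tangent ∞
      (fun q => (⟨q, Y q⟩ : TangentBundle 𝓘(ℝ, E') P)) U ∧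
    ∀ q ∈ U, ∃ h : Y q ∈ S.filt i q, S.solder i q ⟨Y q, h⟩ = v) ∧
  ∃ h : Y p ∈ S.filt i p, S.mkTwo i p ⟨Y p, h⟩ = H.lift i hi v

/-- `c = ω̄₀^i(pr_{i-1}^ℋ([Y₁, Y₂](λ)))`, where `[Y₁, Y₂](λ) ∈ D₀^{i-1}(λ)`. -/
def IsBracketTerm (H : S.ComplTuple p) (i : ℤ) (hi : i < 0)
    (Y₁ Y₂ : ∀ q : P, TangentSpace 𝓘(ℝ, E') q) (c : 𝔪) : Prop :=
  ∃ h : mlieBracket 𝓘(ℝ, E') Y₁ Y₂ p ∈ S.filt (i - 1) p,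
    c = S.solderBar (i - 1 + 1) p
      (H.pr (i - 1) (by omega) (S.mkTwo (i - 1) p ⟨mlieBracket 𝓘(ℝ, E') Y₁ Y₂ p, h⟩))

open Classical in
/-- The structure function `C_ℋ^0(v₁, v₂) = ω̄₀^i(pr_{i-1}^ℋ([Y₁, Y₂](λ)))` of a tuple `ℋ`, for
`v₁ ∈ 𝔤^{-1}` and `v₂ ∈ 𝔤^i`, `i < 0`, where `Y₁`, `Y₂` is any pair of vector fields adapted to `ℋ` and
`v₁`, `v₂`. -/
def structureFunction (H : S.ComplTuple p) (i : ℤ) (hi : i < 0) (v₁ : 𝔤.piece (-1))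
    (v₂ : 𝔤.piece i) : 𝔪 :=
  if h : ∃ c : 𝔪, ∃ Y₁ Y₂ : ∀ q : P, TangentSpace 𝓘(ℝ, E') q,
      H.IsAdapted (-1) (by decide) v₁ Y₁ ∧ H.IsAdapted i hi v₂ Y₂ ∧ H.IsBracketTerm i hi Y₁ Y₂ c
  then h.choose else 0

/-- The difference `φ^ℋ'(v) - φ^ℋ(v)`, which belongs to `D₀^{i+1}(λ) / D₀^{i+2}(λ)`. -/
def gap (H H' : S.ComplTuple p) (i : ℤ) (hi : i < 0) : 𝔤.piece i →ₗ[ℝ] S.Gr (i + 1) p :=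
  (LinearEquiv.ofInjective (S.grIncl i p) (S.grIncl_injective i p)).symm.toLinearMap ∘ₗ
    (H'.lift i hi - H.lift i hi).codRestrict (LinearMap.range (S.grIncl i p)) fun v => by
      rw [← S.ker_twoToSymbol hi, LinearMap.mem_ker, LinearMap.sub_apply, map_sub,
        twoToSymbol_lift, twoToSymbol_lift, sub_self]

lemma grIncl_gap (H H' : S.ComplTuple p) (i : ℤ) (hi : i < 0) (v : 𝔤.piece i) :
    S.grIncl i p (gap H H' i hi v) = H'.lift i hi v - H.lift i hi v :=
  congrArg Subtype.val ((LinearEquiv.ofInjective (S.grIncl i p)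
    (S.grIncl_injective i p)).apply_symm_apply _)

end ComplTuple

lemma vert_mem (S : ConstantTypeStructure D ρ E' P) (p : P) {j : ℤ} (hj : j = 0)
    (X : TangentSpace 𝓘(ℝ, F) (1 : G)) : S.vert p X ∈ S.filt j p := by
  subst hj
  have h : S.vert p X ∈ LinearMap.ker (S.dproj p) := by
    rw [← S.range_vert]
    exact ⟨X, rfl⟩
  exact h

/-- `I_λ` as a map from `T_1 G` to `D₀^j(λ) / D₀^{j+1}(λ)` where `j = 0` (so that `D₀^{j+1}(λ) = 0`). -/
def vertGr (S : ConstantTypeStructure D ρ E' P) (p : P) {j : ℤ} (hj : j = 0) :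
    TangentSpace 𝓘(ℝ, F) (1 : G) →ₗ[ℝ] S.Gr j p :=
  Submodule.mkQ _ ∘ₗ (S.vert p).codRestrict (S.filt j p) fun X => S.vert_mem p hj X

lemma vertGr_bijective (S : ConstantTypeStructure D ρ E' P) (p : P) {j : ℤ} (hj : j = 0) :
    Function.Bijective (S.vertGr p hj) := by
  subst hj
  constructor
  · rw [injective_iff_map_eq_zero]
    intro X hX
    have h : S.vert p X ∈ S.filt (0 + 1) p := by
      have h' : (S.vert p).codRestrict (S.filt 0 p) (fun X => S.vert_mem p rfl X) X ∈
          LinearMap.ker ((S.filt (0 + 1) p).submoduleOf (S.filt 0 p)).mkQ := hX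
      rw [Submodule.ker_mkQ] at h'
      exact h'
    have h' : S.vert p X = 0 := h
    exact S.vert_injective p (h'.trans (map_zero _).symm)
  · intro a
    obtain ⟨⟨w, hw⟩, rfl⟩ := Submodule.mkQ_surjective _ a
    have h : w ∈ LinearMap.range (S.vert p) := by
      rw [S.range_vert]
      exact hw
    obtain ⟨X, rfl⟩ := h
    exact ⟨X, rfl⟩

/-- The identification `I_λ : 𝔤^0 = T_1 G ≃ D₀^0(λ)`. -/
def vertEquiv (S : ConstantTypeStructure D ρ E' P) (p : P) {j : ℤ} (hj : j = 0) :
    TangentSpace 𝓘(ℝ, F) (1 : G) ≃ₗ[ℝ] S.Gr j p :=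
  LinearEquiv.ofBijective _ (S.vertGr_bijective p hj)

namespace ComplTuple

/-- The map `f_{ℋ ℋ'} ∈ ⨁_{i < 0} Hom(𝔤^i, 𝔤^{i+1})`: it sends `v ∈ 𝔤^i` to
`ω̄₀^{i+1}(φ^ℋ'(v) - φ^ℋ(v))` if `i < -1`, and to `I_λ^{-1}(φ^ℋ'(v) - φ^ℋ(v))` if `i = -1`. -/
def diffHom (H H' : S.ComplTuple p) : DegreeOneHom ρ := fun i hi =>
  if h : i + 1 = 0 then
    (inDer ∘ₗ ρ.toDer ∘ₗ (S.vertEquiv p h).symm.toLinearMap ∘ₗ gap H H' i hi).codRestrict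
      (extPiece ρ (i + 1)) fun v => by
        rw [extPiece, if_pos h]
        exact ⟨(S.vertEquiv p h).symm (gap H H' i hi v), rfl⟩
  else
    (inM ∘ₗ (𝔤.piece (i + 1)).subtype ∘ₗ S.solderBar (i + 1) p ∘ₗ gap H H' i hi).codRestrict
      (extPiece ρ (i + 1)) fun v => by
        rw [extPiece, if_neg h]
        exact ⟨_, (S.solderBar (i + 1) p (gap H H' i hi v)).2, rfl⟩

end ComplTuple

end ConstantTypeStructure

end Structures

end Tanaka

end

/-! Everything rests on one expansion. Let `Y₁`, `Y₂` be adapted to `H` and `Y₁'`, `Y₂'` to `H'`,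
for the same `v₁`, `v₂`. Then `Z₁ = Y₁' - Y₁` is vertical, `Z₂ = Y₂' - Y₂` is a section of
`D₀^{i+1}`, and `[Y₁', Y₂'] = [Y₁, Y₂] + [Y₁, Z₂] + [Z₁, Y₂']`. At `λ` the last two brackets lie in
`D₀^i`, and `ω₀^i` takes on them the values `[v₁, f v₂]` and `[f v₁, v₂]`. Applying `pr^ℋ` to the
class of a bracket means subtracting a representative of `φ^ℋ([v₁, v₂])`; passing to `ℋ'` changes
that representative by a vector with soldering value `f([v₁, v₂])`. The sum of the changes is `∂₀ f`
(`inM_isBracketTerm`). Independence of choices is the special case `H = H'`, where `f = 0`.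

Two lemmas evaluate the brackets. `HasSolder.mlieBracket`: the bracket of sections of `D₀^{-1}` and
`D₀^i` induces the bracket of `𝔪`. Such fields need not project to `M`, so their bracket is compared
with one on `M` by differentiating the function "chart of `M` after the projection". The error is
the derivative, at a zero, of a section of the pullback of a constant-rank `D^i`, and such a
derivative stays in `D^i` (`vderiv_mem_of_eq_zero`).

`HasSolder.mlieBracket_vert`: if `Z` is vertical with `Z(λ) = I_λ(X)` and `ω₀^i(Y)` is constantly
`v`, then by equivariance the projection of `Y` at `λ · g` represents `φ(g v)`. Differentiating in
`g` gives the soldering value `X v` of `[Z, Y]`.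

Adapted fields exist because `φ v` depends smoothly on `(x, φ)`, the terms of the flag are spanned
by local sections, and fields along a submersion lift with a prescribed value at a point
(`exists_lift_of_surjective`). -/

noncomputable section

namespace Tanaka

/-! ### Vector fields read in a chart -/

section Charts

variable {E : Type*} [NormedAddCommGroup E] [NormedSpace ℝ E]
  {M : Type*} [TopologicalSpace M] [ChartedSpace E M] [IsManifold 𝓘(ℝ, E) ∞ M]

/-- The derivative of a vector-valued function on a manifold. -/
def vderiv {V : Type*} [NormedAddCommGroup V] [NormedSpace ℝ V] (f : M → V) (y : M) :
    TangentSpace 𝓘(ℝ, E) y →L[ℝ] V :=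
  mfderiv 𝓘(ℝ, E) 𝓘(ℝ, V) f y

variable (E) in
/-- The derivative at `y` of the preferred chart at `x₀`. -/
def dchart (x₀ y : M) : TangentSpace 𝓘(ℝ, E) y →L[ℝ] E :=
  vderiv (extChartAt 𝓘(ℝ, E) x₀) y

/-- Smoothness of sections is tested in the trivialization of the tangent bundle; this replaces the
trivialization by the derivative of the chart. -/
lemma trivializationAt_snd {x₀ y : M} (hy : y ∈ (chartAt E x₀).source)
    (v : TangentSpace 𝓘(ℝ, E) y) :
    (trivializationAt E (TangentSpace 𝓘(ℝ, E)) x₀ ⟨y, v⟩).2 = dchart E x₀ y v := by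
  have h := TangentBundle.continuousLinearMapAt_trivializationAt (𝕜 := ℝ) (I := 𝓘(ℝ, E)) hy
  refine Eq.trans ?_ (congrArg (fun L => L v) h)
  refine ((trivializationAt E (TangentSpace 𝓘(ℝ, E)) x₀).continuousLinearMapAt_apply_of_mem
    ℝ ?_ v).symm
  simpa using hy

lemma dchart_bijective {x₀ y : M} (hy : y ∈ (chartAt E x₀).source) :
    Function.Bijective (dchart E x₀ y) := by
  obtain ⟨e, he⟩ := isInvertible_mfderiv_extChartAt (I := 𝓘(ℝ, E)) (x := x₀) (y := y)
    (by simpa using hy)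
  have : (dchart E x₀ y : TangentSpace 𝓘(ℝ, E) y → E) = e := by
    rw [dchart, vderiv, ← he]; rfl
  rw [this]
  exact e.bijective

variable {E' : Type*} [NormedAddCommGroup E'] [NormedSpace ℝ E']
  {N : Type*} [TopologicalSpace N] [ChartedSpace E' N]

/-- Smoothness of a vector field along a map, read in a chart. -/
lemma contMDiffOn_along_iff {b : N → M} {s : Set N} {x₀ : M}
    (hb : ContMDiffOn 𝓘(ℝ, E') 𝓘(ℝ, E) ∞ b s) (hs : Set.MapsTo b s (chartAt E x₀).source)
    (W : ∀ q, TangentSpace 𝓘(ℝ, E) (b q)) :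
    ContMDiffOn 𝓘(ℝ, E') 𝓘(ℝ, E).tangent ∞
        (fun q => (⟨b q, W q⟩ : TangentBundle 𝓘(ℝ, E) M)) s ↔
      ContMDiffOn 𝓘(ℝ, E') 𝓘(ℝ, E) ∞ (fun q => dchart E x₀ (b q) (W q)) s := by
  have h := (trivializationAt E (TangentSpace 𝓘(ℝ, E)) x₀).contMDiffOn_iff
    (IM := 𝓘(ℝ, E')) (IB := 𝓘(ℝ, E)) (n := ∞) (s := s)
    (f := fun q => (⟨b q, W q⟩ : TangentBundle 𝓘(ℝ, E) M))
    (fun q hq => by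
      rw [Bundle.Trivialization.mem_source]
      simpa using hs hq)
  refine h.trans ⟨fun h => h.2.congr fun q hq => (trivializationAt_snd (hs hq) _).symm,
    fun h => ⟨hb, h.congr fun q hq => trivializationAt_snd (hs hq) _⟩⟩

end Charts

/-! ### The Lie bracket as a commutator of derivations -/

section Derivation

variable {E : Type*} [NormedAddCommGroup E] [NormedSpace ℝ E] [CompleteSpace E]
  {M : Type*} [TopologicalSpace M] [ChartedSpace E M] [IsManifold 𝓘(ℝ, E) ∞ M]
  {V : Type*} [NormedAddCommGroup V] [NormedSpace ℝ V]

/-- The chain rule for the coordinate expression `g` of `f`. The point `q` may differ from the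
centre `p` of the chart because the resulting function of `q` is differentiated again. -/
lemma vderiv_eq_fderiv_comp_dchart {p q : M} {f : M → V} {g : E → V}
    (hg : DifferentiableAt ℝ g (extChartAt 𝓘(ℝ, E) p q)) (hq : q ∈ (chartAt E p).source)
    (hfg : f =ᶠ[𝓝 q] g ∘ extChartAt 𝓘(ℝ, E) p) (u : TangentSpace 𝓘(ℝ, E) q) :
    vderiv f q u =
      fderiv ℝ g (extChartAt 𝓘(ℝ, E) p q) (dchart E p q u) := by
  have h1 : HasMFDerivAt 𝓘(ℝ, E) 𝓘(ℝ, V) (g ∘ extChartAt 𝓘(ℝ, E) p) q _ :=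
    hg.hasFDerivAt.hasMFDerivAt.comp q
      (mdifferentiableAt_extChartAt (I := 𝓘(ℝ, E)) hq).hasMFDerivAt
  rw [vderiv, (h1.congr_of_eventuallyEq hfg).mfderiv]
  rfl

/-- `mlieBracket` is defined through the pullback by the inverse chart; near `p` that pullback is
the coordinate expression of the field. -/
lemma eventually_mpullbackWithin_eq (p : M) (Y : ∀ q : M, TangentSpace 𝓘(ℝ, E) q) :
    ∀ᶠ q in 𝓝 p, mpullbackWithin 𝓘(ℝ, E) 𝓘(ℝ, E) (extChartAt 𝓘(ℝ, E) p).symm Y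
      (Set.range 𝓘(ℝ, E)) (extChartAt 𝓘(ℝ, E) p q) = dchart E p q (Y q) := by
  have h := eventuallyEq_mpullback_mpullbackWithin_extChartAt (I := 𝓘(ℝ, E)) (s := Set.univ)
    (x := p) Y
  rw [nhdsWithin_univ] at h
  filter_upwards [h, (chartAt E p).open_source.mem_nhds (mem_chart_source E p)] with q hq hqs
  rw [hq, mpullback_apply]
  obtain ⟨e, he⟩ := isInvertible_mfderiv_extChartAt (I := 𝓘(ℝ, E)) (x := p) (y := q)
    (by simpa using hqs)
  rw [dchart, vderiv, ← he, ContinuousLinearMap.inverse_equiv]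
  exact (e.apply_symm_apply _).symm

/-- The Lie bracket of vector fields is the commutator of the corresponding derivations. -/
lemma vderiv_apply_mlieBracket {f : M → V} {p : M} {Y₁ Y₂ : ∀ q : M, TangentSpace 𝓘(ℝ, E) q}
    (hf : ContMDiffAt 𝓘(ℝ, E) 𝓘(ℝ, V) 2 f p)
    (h₁ : MDifferentiableAt 𝓘(ℝ, E) 𝓘(ℝ, E).tangent
      (fun q => (⟨q, Y₁ q⟩ : TangentBundle 𝓘(ℝ, E) M)) p)
    (h₂ : MDifferentiableAt 𝓘(ℝ, E) 𝓘(ℝ, E).tangent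
      (fun q => (⟨q, Y₂ q⟩ : TangentBundle 𝓘(ℝ, E) M)) p) :
    vderiv f p (mlieBracket 𝓘(ℝ, E) Y₁ Y₂ p) =
      vderiv (fun q => vderiv f q (Y₂ q)) p (Y₁ p) -
        vderiv (fun q => vderiv f q (Y₁ q)) p (Y₂ p) := by
  set φ := extChartAt 𝓘(ℝ, E) p with hφ
  set g : E → V := f ∘ φ.symm with hg
  have hgs : ContDiffAt ℝ 2 g (φ p) := by
    have := (contMDiffAt_iff.1 hf).2
    rw [ModelWithCorners.range_eq_univ, contDiffWithinAt_univ] at this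
    exact this
  have hgd : ∀ᶠ e in 𝓝 (φ p), ContDiffAt ℝ 2 g e := hgs.eventually (by simp)
  have hcont : Filter.Tendsto φ (𝓝 p) (𝓝 (φ p)) := continuousAt_extChartAt p
  have hsrc : ∀ᶠ q in 𝓝 p, q ∈ (chartAt E p).source :=
    (chartAt E p).open_source.mem_nhds (mem_chart_source E p)
  have hfg : f =ᶠ[𝓝 p] g ∘ φ := by
    filter_upwards [hsrc] with q hq
    simp only [hg, Function.comp_apply, hφ]
    rw [PartialEquiv.left_inv _ (by simpa using hq)]
  have hZd : ∀ {Y : ∀ q : M, TangentSpace 𝓘(ℝ, E) q}, MDifferentiableAt 𝓘(ℝ, E) 𝓘(ℝ, E).tangent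
      (fun q => (⟨q, Y q⟩ : TangentBundle 𝓘(ℝ, E) M)) p → DifferentiableAt ℝ
      (mpullbackWithin 𝓘(ℝ, E) 𝓘(ℝ, E) φ.symm Y (Set.range 𝓘(ℝ, E)) : E → E) (φ p) := by
    intro Y hY
    have := (hY.mdifferentiableWithinAt
      (s := Set.univ)).differentiableWithinAt_mpullbackWithin_vectorField
    have hu : φ.symm ⁻¹' Set.univ ∩ Set.range 𝓘(ℝ, E) = Set.univ := by simp
    rw [hu] at this
    exact differentiableWithinAt_univ.1 this
  -- The identity in the model space, for coordinate expressions. What remains is to transport its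
  -- terms to `M`.
  have key := fderiv_apply_lieBracket hgs (by simp) (hZd h₂) (hZd h₁)
  have hread : ∀ Y : ∀ q : M, TangentSpace 𝓘(ℝ, E) q,
      (fun q => vderiv f q (Y q)) =ᶠ[𝓝 p]
        (fun e => fderiv ℝ g e
          (mpullbackWithin 𝓘(ℝ, E) 𝓘(ℝ, E) φ.symm Y (Set.range 𝓘(ℝ, E)) e : E)) ∘ φ := by
    intro Y
    filter_upwards [eventually_mpullbackWithin_eq p Y, hfg.eventually_nhds, hsrc,
      hcont.eventually hgd] with q h1 h2 h3 h4
    refine (vderiv_eq_fderiv_comp_dchart (h4.differentiableAt (by simp)) h3 h2 _).trans ?_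
    exact congrArg _ h1.symm
  have hdd : ∀ {Z : E → E}, DifferentiableAt ℝ Z (φ p) →
      DifferentiableAt ℝ (fun e => fderiv ℝ g e (Z e)) (φ p) := fun hZ =>
    ((hgs.fderiv_right (m := 1) (by norm_num)).differentiableAt (by simp)).clm_apply hZ
  have hp := mem_chart_source E p
  have hright : ∀ {Y : ∀ q : M, TangentSpace 𝓘(ℝ, E) q} (Y' : ∀ q : M, TangentSpace 𝓘(ℝ, E) q),
      DifferentiableAt ℝ
        (mpullbackWithin 𝓘(ℝ, E) 𝓘(ℝ, E) φ.symm Y (Set.range 𝓘(ℝ, E)) : E → E) (φ p) →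
      vderiv (fun q => vderiv f q (Y q)) p (Y' p) =
        fderiv ℝ (fun e => fderiv ℝ g e
          (mpullbackWithin 𝓘(ℝ, E) 𝓘(ℝ, E) φ.symm Y (Set.range 𝓘(ℝ, E)) e : E)) (φ p)
          (mpullbackWithin 𝓘(ℝ, E) 𝓘(ℝ, E) φ.symm Y' (Set.range 𝓘(ℝ, E)) (φ p)) := fun Y' hY =>
    (vderiv_eq_fderiv_comp_dchart (hdd hY) hp (hread _) _).trans
      (congrArg _ (eventually_mpullbackWithin_eq p Y').self_of_nhds.symm)
  rw [hright Y₁ (hZd h₂), hright Y₂ (hZd h₁)]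
  refine Eq.trans ?_ key
  refine (vderiv_eq_fderiv_comp_dchart (hgs.differentiableAt (by simp)) hp hfg _).trans ?_
  refine congrArg _ ?_
  -- The bracket at `p` is the inverse of the derivative of the chart applied to the bracket of the
  -- coordinate expressions; `dchart` cancels that inverse.
  rw [← mlieBracketWithin_univ, mlieBracketWithin_apply]
  obtain ⟨e, he⟩ := isInvertible_mfderiv_extChartAt (I := 𝓘(ℝ, E)) (x := p) (y := p) (by simp)
  rw [dchart, vderiv, ← he, ContinuousLinearMap.inverse_equiv]
  refine (e.apply_symm_apply _).trans ?_
  have hu : φ.symm ⁻¹' Set.univ ∩ Set.range 𝓘(ℝ, E) = Set.univ := by simp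
  rw [hu]
  exact congrFun (lieBracketWithin_univ (𝕜 := ℝ) (E := E)) _

end Derivation

/-! ### Sections of a family of subspaces of constant rank -/

section ContinuousFrame

variable {N V : Type*} [TopologicalSpace N]
  [NormedAddCommGroup V] [NormedSpace ℝ V] [FiniteDimensional ℝ V]

/-- A family of subspaces of constant dimension with a continuous local frame is the family of
ranges of operators which restrict to the identity and depend continuously on the point. -/
lemma exists_continuousAt_projection {K : N → Submodule ℝ V} {p : N}
    (hrank : ∀ᶠ q in 𝓝 p, Module.finrank ℝ (K q) = Module.finrank ℝ (K p))
    (hframe : ∀ v ∈ K p, ∃ X : N → V, ContinuousAt X p ∧ X p = v ∧ ∀ᶠ q in 𝓝 p, X q ∈ K q) :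
    ∃ Q : N → V →L[ℝ] V, ContinuousAt Q p ∧ (∀ v, Q p v ∈ K p) ∧
      ∀ᶠ q in 𝓝 p, ∀ v ∈ K q, Q q v = v := by
  set r := Module.finrank ℝ (K p)
  let b : Module.Basis (Fin r) ℝ (K p) := Module.finBasis ℝ (K p)
  choose X hXc hXp hXK using fun k : Fin r => hframe (b k) (b k).2
  -- `A q` sends coefficients to the combination of the frame vectors at `q`. With a left inverse
  -- `B` of `A p`, the product `B ∘ A q` is invertible near `p`, and the required operator is `A (B
  -- A)⁻¹ B`, which is the identity on the range of `A q`.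
  let A : N → (Fin r → ℝ) →L[ℝ] V := fun q =>
    ∑ k, (ContinuousLinearMap.proj (R := ℝ) (φ := fun _ : Fin r => ℝ) k).smulRight (X k q)
  have hA : ∀ q c, A q c = ∑ k, c k • X k q := fun q c => by
    simp [A]
  have hAc : ContinuousAt A p := by
    refine tendsto_finsetSum _ fun k _ => ?_
    exact ((ContinuousLinearMap.smulRightL ℝ (Fin r → ℝ) V
      (ContinuousLinearMap.proj (R := ℝ) (φ := fun _ : Fin r => ℝ) k)).continuous.continuousAt
      (x := X k p)).comp (hXc k)
  have hAinj : LinearMap.ker (A p).toLinearMap = ⊥ := by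
    rw [LinearMap.ker_eq_bot']
    intro c hc
    have h1 : ∑ k, c k • (b k : V) = 0 := by
      rw [← hc]
      refine Eq.trans ?_ (hA p c).symm
      exact Finset.sum_congr rfl fun k _ => by rw [hXp]
    have h2 : ∑ k, c k • b k = 0 := Subtype.ext (by simpa using h1)
    funext k
    exact Fintype.linearIndependent_iff.1 b.linearIndependent c h2 k
  obtain ⟨B', hB'⟩ := LinearMap.exists_leftInverse_of_injective (A p).toLinearMap hAinj
  let B : V →L[ℝ] (Fin r → ℝ) := LinearMap.toContinuousLinearMap B'
  let C : N → (Fin r → ℝ) →L[ℝ] (Fin r → ℝ) := fun q => B.comp (A q)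
  have hCp : C p = 1 := by
    ext1 c
    exact congrArg (fun L : (Fin r → ℝ) →ₗ[ℝ] (Fin r → ℝ) => L c) hB'
  have hCc : ContinuousAt C p := continuousAt_const.clm_comp hAc
  have hCu : ∀ᶠ q in 𝓝 p, IsUnit (C q) := by
    have : {T : (Fin r → ℝ) →L[ℝ] (Fin r → ℝ) | IsUnit T} ∈ 𝓝 (C p) :=
      Units.isOpen.mem_nhds (by rw [hCp]; exact isUnit_one)
    exact hCc this
  have hinv : ContinuousAt (fun q => Ring.inverse (C q)) p := by
    have h : ContinuousAt Ring.inverse (C p) := by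
      rw [hCp]; exact NormedRing.inverse_continuousAt 1
    exact h.comp hCc
  refine ⟨fun q => (A q).comp ((Ring.inverse (C q)).comp B),
    hAc.clm_comp (hinv.clm_comp continuousAt_const), fun v => ?_, ?_⟩
  · change A p _ ∈ K p
    rw [hA]
    exact Submodule.sum_mem _ fun k _ => Submodule.smul_mem _ _ (by rw [hXp]; exact (b k).2)
  · filter_upwards [hCu, hrank, Filter.eventually_all.2 hXK] with q hu hr hX v hv
    have hinvC : ∀ c, Ring.inverse (C q) (B (A q c)) = c := fun c =>
      congrArg (fun L : (Fin r → ℝ) →L[ℝ] (Fin r → ℝ) => L c) (Ring.inverse_mul_cancel _ hu)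
    have hinj : Function.Injective (A q).toLinearMap := fun c c' h => by
      rw [← hinvC c, ← hinvC c']
      exact congrArg (fun w => Ring.inverse (C q) (B w)) h
    have hle : LinearMap.range (A q).toLinearMap ≤ K q := by
      rintro _ ⟨c, rfl⟩
      change A q c ∈ K q
      rw [hA]
      exact Submodule.sum_mem _ fun k _ => Submodule.smul_mem _ _ (hX k)
    -- Constancy of the rank enters here: the range lies in `K q` and has the same dimension.
    have heq : LinearMap.range (A q).toLinearMap = K q := by
      refine Submodule.eq_of_le_of_finrank_eq hle ?_
      rw [LinearMap.finrank_range_of_inj hinj, hr]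
      simp [r]
    rw [← heq] at hv
    obtain ⟨c, rfl⟩ := hv
    exact congrArg (A q) (hinvC c)

variable {E : Type*} [NormedAddCommGroup E] [NormedSpace ℝ E] [ChartedSpace E N]
  [IsManifold 𝓘(ℝ, E) ∞ N]

/-- The derivative of a section of a family of subspaces at a zero of the section takes its values
in the subspace. -/
lemma vderiv_mem_of_eq_zero {K : N → Submodule ℝ V} {p : N} {f : N → V}
    (hrank : ∀ᶠ q in 𝓝 p, Module.finrank ℝ (K q) = Module.finrank ℝ (K p))
    (hframe : ∀ v ∈ K p, ∃ X : N → V, ContinuousAt X p ∧ X p = v ∧ ∀ᶠ q in 𝓝 p, X q ∈ K q)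
    (hf : MDifferentiableAt 𝓘(ℝ, E) 𝓘(ℝ, V) f p) (hfK : ∀ᶠ q in 𝓝 p, f q ∈ K q) (hfp : f p = 0)
    (u : TangentSpace 𝓘(ℝ, E) p) : vderiv f p u ∈ K p := by
  obtain ⟨Q, hQc, hQp, hQ⟩ := exists_continuousAt_projection hrank hframe
  set φ := extChartAt 𝓘(ℝ, E) p with hφ
  have hφp : φ.symm (φ p) = p := extChartAt_to_inv p
  have hsymm : Filter.Tendsto φ.symm (𝓝 (φ p)) (𝓝 p) := by
    have := continuousAt_extChartAt_symm (I := 𝓘(ℝ, E)) p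
    rwa [ContinuousAt, extChartAt_to_inv] at this
  have hd : DifferentiableAt ℝ (f ∘ φ.symm) (φ p) := by
    have := (mdifferentiableAt_iff _ _).1 hf |>.2
    rw [ModelWithCorners.range_eq_univ, differentiableWithinAt_univ] at this
    exact this
  have hmf : ∀ u : TangentSpace 𝓘(ℝ, E) p,
      vderiv f p u = fderiv ℝ (f ∘ φ.symm) (φ p) u := fun u => by
    rw [vderiv, hf.mfderiv, ModelWithCorners.range_eq_univ, fderivWithin_univ]
    rfl
  set L := fderiv ℝ (f ∘ φ.symm) (φ p) with hL
  have h1 : HasFDerivAt (f ∘ φ.symm) L (φ p) := hd.hasFDerivAt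
  -- Near `p` one has `f = Q f = Q p f + (Q - Q p) f`. The last term is `o(e - φ p)`, since `Q - Q
  -- p` tends to zero and `f`, vanishing at `p`, is `O(e - φ p)`. Hence `L = Q p ∘ L` takes values
  -- in `K p`. Only continuity of `Q` is needed.
  have h2 : HasFDerivAt (f ∘ φ.symm) ((Q p).comp L) (φ p) := by
    have h3 : HasFDerivAt (fun e => Q p ((f ∘ φ.symm) e)) ((Q p).comp L) (φ p) :=
      (Q p).hasFDerivAt.comp (φ p) h1
    have hQ0 : Filter.Tendsto (fun e => Q (φ.symm e) - Q p) (𝓝 (φ p)) (𝓝 0) := by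
      have := (hQc.tendsto.comp hsymm).sub_const (Q p)
      simpa using this
    have h4 : HasFDerivAt (fun e => (Q (φ.symm e) - Q p) ((f ∘ φ.symm) e)) (0 : E →L[ℝ] V)
        (φ p) := by
      refine HasFDerivAt.of_isLittleO ?_
      have hO : (fun e => (f ∘ φ.symm) e) =O[𝓝 (φ p)] fun e => e - φ p := by
        have := h1.isBigO_sub
        simpa [hφp, hfp] using this
      have ho : (fun e => Q (φ.symm e) - Q p) =o[𝓝 (φ p)] fun _ => (1 : ℝ) :=
        (Asymptotics.isLittleO_one_iff ℝ).2 hQ0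
      have hmul : (fun e => ‖Q (φ.symm e) - Q p‖ * ‖(f ∘ φ.symm) e‖) =o[𝓝 (φ p)]
          fun e => (1 : ℝ) * ‖e - φ p‖ := ho.norm_left.mul_isBigO hO.norm_norm
      have : (fun e => (Q (φ.symm e) - Q p) ((f ∘ φ.symm) e)) =o[𝓝 (φ p)] fun e => e - φ p := by
        refine Asymptotics.IsBigO.trans_isLittleO (g := fun e =>
          ‖Q (φ.symm e) - Q p‖ * ‖(f ∘ φ.symm) e‖) ?_ ?_
        · refine Asymptotics.IsBigO.of_bound 1 (Filter.Eventually.of_forall fun e => ?_)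
          rw [one_mul, Real.norm_of_nonneg (by positivity)]
          exact ContinuousLinearMap.le_opNorm _ _
        · simpa using hmul
      simpa [hφp, hfp] using this
    have h5 := h3.add h4
    rw [add_zero] at h5
    refine h5.congr_of_eventuallyEq ?_
    filter_upwards [hsymm.eventually hQ, hsymm.eventually hfK] with e he hfe
    have h6 : Q (φ.symm e) (f (φ.symm e)) = f (φ.symm e) := he _ hfe
    simp [h6]
  rw [hmf, h1.unique h2]
  exact hQp _

end ContinuousFrame

/-! ### Rules for derivatives of vector-valued functions -/

section VectorDerivative

variable {E : Type*} [NormedAddCommGroup E] [NormedSpace ℝ E]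
  {M : Type*} [TopologicalSpace M] [ChartedSpace E M]
  {V : Type*} [NormedAddCommGroup V] [NormedSpace ℝ V]
  {E' : Type*} [NormedAddCommGroup E'] [NormedSpace ℝ E']
  {N : Type*} [TopologicalSpace N] [ChartedSpace E' N]

lemma vderiv_sub {f g : M → V} {p : M} (hf : MDifferentiableAt 𝓘(ℝ, E) 𝓘(ℝ, V) f p)
    (hg : MDifferentiableAt 𝓘(ℝ, E) 𝓘(ℝ, V) g p) (u : TangentSpace 𝓘(ℝ, E) p) :
    vderiv (fun q => f q - g q) p u = vderiv f p u - vderiv g p u :=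
  congrArg (fun L => L u) (hf.hasMFDerivAt.sub hg.hasMFDerivAt).mfderiv

lemma vderiv_const (c : V) (p : M) (u : TangentSpace 𝓘(ℝ, E) p) :
    vderiv (fun _ : M => c) p u = 0 :=
  congrArg (fun L : TangentSpace 𝓘(ℝ, E) p →L[ℝ] V => L u) (hasMFDerivAt_const c p).mfderiv

lemma vderiv_congr {f g : M → V} {p : M} (h : f =ᶠ[𝓝 p] g) (u : TangentSpace 𝓘(ℝ, E) p) :
    vderiv f p u = vderiv g p u :=
  congrArg (fun L : TangentSpace 𝓘(ℝ, E) p →L[ℝ] V => L u) h.mfderiv_eq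

lemma vderiv_comp {f : M → V} {b : N → M} {p : N}
    (hf : MDifferentiableAt 𝓘(ℝ, E) 𝓘(ℝ, V) f (b p))
    (hb : MDifferentiableAt 𝓘(ℝ, E') 𝓘(ℝ, E) b p) (u : TangentSpace 𝓘(ℝ, E') p) :
    vderiv (fun q => f (b q)) p u = vderiv f (b p) (mfderiv 𝓘(ℝ, E') 𝓘(ℝ, E) b p u) :=
  congrArg (fun L => L u) (hf.hasMFDerivAt.comp p hb.hasMFDerivAt).mfderiv

lemma vderiv_clm_comp {V' : Type*} [NormedAddCommGroup V'] [NormedSpace ℝ V'] (ℓ : V →L[ℝ] V')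
    {f : M → V} {p : M} (hf : MDifferentiableAt 𝓘(ℝ, E) 𝓘(ℝ, V) f p)
    (u : TangentSpace 𝓘(ℝ, E) p) :
    vderiv (fun q => ℓ (f q)) p u = ℓ (vderiv f p u) :=
  congrArg (fun L => L u)
    ((ℓ.hasFDerivAt (x := f p)).hasMFDerivAt.comp p hf.hasMFDerivAt).mfderiv

end VectorDerivative

/-! ### Local sections of the weak derived flag -/

section LocalSection

variable {E : Type*} [NormedAddCommGroup E] [NormedSpace ℝ E]
  {M : Type*} [TopologicalSpace M] [ChartedSpace E M] [IsManifold 𝓘(ℝ, E) ∞ M]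
  {K K' : ∀ x : M, Submodule ℝ (TangentSpace 𝓘(ℝ, E) x)} {x : M}
  {X X' : ∀ x : M, TangentSpace 𝓘(ℝ, E) x}

lemma IsLocalSection.contMDiffAt (h : IsLocalSection K X x) :
    ContMDiffAt 𝓘(ℝ, E) 𝓘(ℝ, E).tangent ∞
      (fun y => (⟨y, X y⟩ : TangentBundle 𝓘(ℝ, E) M)) x := by
  obtain ⟨U, hU, hx, hs, -⟩ := h
  exact hs.contMDiffAt (hU.mem_nhds hx)

lemma IsLocalSection.mdifferentiableAt (h : IsLocalSection K X x) :
    MDifferentiableAt 𝓘(ℝ, E) 𝓘(ℝ, E).tangent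
      (fun y => (⟨y, X y⟩ : TangentBundle 𝓘(ℝ, E) M)) x :=
  h.contMDiffAt.mdifferentiableAt (by simp)

lemma IsLocalSection.eventually_mem (h : IsLocalSection K X x) : ∀ᶠ y in 𝓝 x, X y ∈ K y := by
  obtain ⟨U, hU, hx, -, h⟩ := h
  filter_upwards [hU.mem_nhds hx] with y hy using h y hy

lemma IsLocalSection.mono (h : IsLocalSection K X x) (hK : ∀ y, K y ≤ K' y) :
    IsLocalSection K' X x := by
  obtain ⟨U, hU, hx, hs, h⟩ := h
  exact ⟨U, hU, hx, hs, fun y hy => hK y (h y hy)⟩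

lemma isLocalSection_zero : IsLocalSection K 0 x :=
  ⟨Set.univ, isOpen_univ, trivial,
    (Bundle.contMDiff_zeroSection ℝ (TangentSpace 𝓘(ℝ, E))).contMDiffOn,
    fun y _ => (K y).zero_mem⟩

lemma IsLocalSection.add (h : IsLocalSection K X x) (h' : IsLocalSection K X' x) :
    IsLocalSection K (X + X') x := by
  obtain ⟨U, hU, hx, hs, h⟩ := h
  obtain ⟨U', hU', hx', hs', h'⟩ := h'
  exact ⟨U ∩ U', hU.inter hU', ⟨hx, hx'⟩,
    (hs.mono Set.inter_subset_left).add_section (hs'.mono Set.inter_subset_right),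
    fun y hy => (K y).add_mem (h y hy.1) (h' y hy.2)⟩

lemma IsLocalSection.smul (c : ℝ) (h : IsLocalSection K X x) : IsLocalSection K (c • X) x := by
  obtain ⟨U, hU, hx, hs, h⟩ := h
  exact ⟨U, hU, hx, hs.const_smul_section, fun y hy => (K y).smul_mem c (h y hy)⟩

lemma IsLocalSection.sub (h : IsLocalSection K X x) (h' : IsLocalSection K X' x) :
    IsLocalSection K (X - X') x := by
  have := h.add (h'.smul (-1))
  rwa [neg_one_smul, ← sub_eq_add_neg] at this

/-- The vectors which extend to local sections of `K` form a subspace. -/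
def sectionValues (K : ∀ x : M, Submodule ℝ (TangentSpace 𝓘(ℝ, E) x)) (x : M) :
    Submodule ℝ (TangentSpace 𝓘(ℝ, E) x) where
  carrier := {v | ∃ X, IsLocalSection K X x ∧ X x = v}
  zero_mem' := ⟨0, isLocalSection_zero, rfl⟩
  add_mem' := by
    rintro _ _ ⟨X, hX, rfl⟩ ⟨X', hX', rfl⟩
    exact ⟨_, hX.add hX', rfl⟩
  smul_mem' := by
    rintro c _ ⟨X, hX, rfl⟩
    exact ⟨_, hX.smul c, rfl⟩

variable [CompleteSpace E] {D : ∀ x : M, Submodule ℝ (TangentSpace 𝓘(ℝ, E) x)}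

lemma mlieBracket_mem_weakFlag {n : ℕ} (h : IsLocalSection D X x)
    (h' : IsLocalSection (weakFlag D (n + 1)) X' x) :
    mlieBracket 𝓘(ℝ, E) X X' x ∈ weakFlag D (n + 2) x :=
  Submodule.mem_sup_right (Submodule.subset_span ⟨X, X', h, h', rfl⟩)

/-- The two fields are local sections at every point of their common domain, so their bracket
belongs to the next term of the flag at all of these points. -/
lemma IsLocalSection.mlieBracket {n : ℕ} (h : IsLocalSection D X x)
    (h' : IsLocalSection (weakFlag D (n + 1)) X' x) :
    IsLocalSection (weakFlag D (n + 2)) (VectorField.mlieBracket 𝓘(ℝ, E) X X') x := by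
  obtain ⟨U, hU, hx, hs, h⟩ := h
  obtain ⟨U', hU', hx', hs', h'⟩ := h'
  have hUo := hU.inter hU'
  refine ⟨U ∩ U', hUo, ⟨hx, hx'⟩, ?_, fun y hy => mlieBracket_mem_weakFlag
    ⟨U, hU, hy.1, hs, h⟩ ⟨U', hU', hy.2, hs', h'⟩⟩
  intro y hy
  have h1 := hs.contMDiffAt (hU.mem_nhds hy.1)
  have h2 := hs'.contMDiffAt (hU'.mem_nhds hy.2)
  -- The derivative lost in the bracket costs nothing, as `∞ + 1` is `∞`.
  have : IsManifold 𝓘(ℝ, E) (((⊤ : ℕ∞) : WithTop ℕ∞) + 1) M :=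
    inferInstanceAs (IsManifold 𝓘(ℝ, E) ∞ M)
  have : IsManifold 𝓘(ℝ, E) (minSmoothness ℝ 2) M := by
    rw [minSmoothness_of_isRCLikeNormedField]
    infer_instance
  exact (h1.mlieBracket_vectorField (m := ⊤) (n := ⊤) h2 (by simp)).contMDiffWithinAt

/-- The extendable vectors form a subspace, so it suffices to extend generators: those of the
previous term by induction, and a bracket of sections by the bracket field itself. -/
lemma weakFlag_le_sectionValues (hD : IsRegularDistribution D) (n : ℕ) (x : M) :
    weakFlag D n x ≤ sectionValues (weakFlag D n) x := by
  induction n using Nat.strong_induction_on with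
  | _ n ih =>
    match n, ih with
    | 0, _ => exact bot_le
    | 1, _ => exact fun v hv => hD.smooth x v hv
    | n + 2, ih =>
      refine sup_le (fun v hv => ?_) (Submodule.span_le.2 ?_)
      · obtain ⟨X, hX, rfl⟩ := ih (n + 1) (by omega) hv
        exact ⟨X, hX.mono fun y => le_sup_left, rfl⟩
      · rintro _ ⟨X, Y, hX, hY, rfl⟩
        exact ⟨_, hX.mlieBracket hY, rfl⟩

/-- The terms of the weak derived flag are spanned by smooth local sections. -/
lemma exists_isLocalSection_flag (hD : IsRegularDistribution D) {i : ℤ}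
    {v : TangentSpace 𝓘(ℝ, E) x} (hv : v ∈ flag D i x) :
    ∃ X, IsLocalSection (flag D i) X x ∧ X x = v :=
  weakFlag_le_sectionValues hD _ x hv

lemma mlieBracket_mem_flag {i : ℤ} (hi : i < 0) (h : IsLocalSection (flag D (-1)) X x)
    (h' : IsLocalSection (flag D i) X' x) :
    VectorField.mlieBracket 𝓘(ℝ, E) X X' x ∈ flag D (-1 + i) x := by
  obtain ⟨n, rfl⟩ : ∃ n : ℕ, i = -((n + 1 : ℕ) : ℤ) := ⟨(-i - 1).toNat, by omega⟩
  have e1 : (-(-((n + 1 : ℕ) : ℤ))).toNat = n + 1 := by omega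
  have e2 : (-(-1 + -((n + 1 : ℕ) : ℤ))).toNat = n + 2 := by omega
  unfold flag at h h' ⊢
  rw [e1] at h'
  rw [e2]
  exact mlieBracket_mem_weakFlag h h'

lemma flag_anti {i j : ℤ} (hij : i ≤ j) (x : M) : flag D j x ≤ flag D i x := by
  obtain ⟨n, rfl⟩ := Int.le.dest hij
  induction n with
  | zero => simp
  | succ n ih =>
    have := ConstantTypeStructure.flag_succ_le D (i + n) x
    rw [Nat.cast_succ, ← add_assoc]
    exact this.trans (ih (by omega))

lemma flag_zero (x : M) : flag D 0 x = ⊥ := rfl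

/-- Degree `0` is included because corrections by sections of `D^{i+1}` are made also for `i = -1`;
a section of `D^0 = 0` vanishes near `x`, and its brackets vanish at `x`. -/
lemma IsLocalSection.mlieBracket_right_mem_flag {i : ℤ} (hi : i ≤ 0)
    (h : IsLocalSection (flag D (-1)) X x) (h' : IsLocalSection (flag D i) X' x) :
    VectorField.mlieBracket 𝓘(ℝ, E) X X' x ∈ flag D (-1 + i) x := by
  rcases hi.lt_or_eq with hi | rfl
  · exact mlieBracket_mem_flag hi h h'
  · have h0 : X' =ᶠ[𝓝 x] (0 : ∀ y : M, TangentSpace 𝓘(ℝ, E) y) := by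
      filter_upwards [h'.eventually_mem] with y hy
      rw [flag_zero] at hy
      exact (Submodule.mem_bot ℝ).1 hy
    rw [(Filter.EventuallyEq.refl _ X).mlieBracket_vectorField_eq h0]
    have h1 := congrFun (mlieBracket_zero_right (I := 𝓘(ℝ, E)) (W := X)) x
    exact (congrArg (· ∈ flag D (-1 + 0) x) h1).mpr (zero_mem _)

end LocalSection

/-! ### Brackets of non-projectable fields compared with brackets on the base -/

section Projection

variable {E : Type*} [NormedAddCommGroup E] [NormedSpace ℝ E] [FiniteDimensional ℝ E]
  {M : Type*} [TopologicalSpace M] [ChartedSpace E M] [IsManifold 𝓘(ℝ, E) ∞ M]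
  {D : ∀ x : M, Submodule ℝ (TangentSpace 𝓘(ℝ, E) x)}
  {E' : Type*} [NormedAddCommGroup E'] [NormedSpace ℝ E'] [FiniteDimensional ℝ E']
  {N : Type*} [TopologicalSpace N] [ChartedSpace E' N] [IsManifold 𝓘(ℝ, E') ∞ N]
  {b : N → M} {p : N}

lemma contMDiffAt_along {W : ∀ q, TangentSpace 𝓘(ℝ, E) (b q)} {U : Set N} {x₀ : M}
    (hb : ContMDiff 𝓘(ℝ, E') 𝓘(ℝ, E) ∞ b) (hU : IsOpen U)
    (hp : p ∈ U) (hx₀ : b p ∈ (chartAt E x₀).source)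
    (hW : ContMDiffOn 𝓘(ℝ, E') 𝓘(ℝ, E).tangent ∞
      (fun q => (⟨b q, W q⟩ : TangentBundle 𝓘(ℝ, E) M)) U) :
    ContMDiffAt 𝓘(ℝ, E') 𝓘(ℝ, E) ∞ (fun q => dchart E x₀ (b q) (W q)) p := by
  have ho : IsOpen (U ∩ b ⁻¹' (chartAt E x₀).source) :=
    hU.inter ((chartAt E x₀).open_source.preimage hb.continuous)
  exact ((contMDiffOn_along_iff hb.contMDiffOn (fun q hq => hq.2) W).1
    (hW.mono Set.inter_subset_left)).contMDiffAt (ho.mem_nhds ⟨hp, hx₀⟩)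

lemma IsLocalSection.contMDiffAt_dchart {K : ∀ x : M, Submodule ℝ (TangentSpace 𝓘(ℝ, E) x)}
    {X : ∀ x : M, TangentSpace 𝓘(ℝ, E) x} {x x₀ : M} (h : IsLocalSection K X x)
    (hx₀ : x ∈ (chartAt E x₀).source) :
    ContMDiffAt 𝓘(ℝ, E) 𝓘(ℝ, E) ∞ (fun y => dchart E x₀ y (X y)) x := by
  obtain ⟨U, hU, hx, hs, -⟩ := h
  exact contMDiffAt_along (b := id) contMDiff_id hU hx hx₀ hs

lemma finrank_map_dchart {x₀ y : M} (hy : y ∈ (chartAt E x₀).source)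
    (K : Submodule ℝ (TangentSpace 𝓘(ℝ, E) y)) :
    Module.finrank ℝ (K.map (dchart E x₀ y).toLinearMap) = Module.finrank ℝ K :=
  (Submodule.equivMapOfInjective _ (dchart_bijective hy).1 K).finrank_eq.symm

lemma eventually_mem_chart_source (hb : Continuous b) :
    ∀ᶠ q in 𝓝 p, b q ∈ (chartAt E (b p)).source :=
  hb.continuousAt.eventually ((chartAt E (b p)).open_source.mem_nhds (mem_chart_source E (b p)))

/-- Two sections of the pullback of `D^i` with the same value at `p` have the same derivative at `p`
modulo `D^i`. -/
lemma vderiv_dchart_sub_mem (hD : IsRegularDistribution D) {i : ℤ} (hi : i < 0)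
    (hb : ContMDiff 𝓘(ℝ, E') 𝓘(ℝ, E) ∞ b) {W : ∀ q, TangentSpace 𝓘(ℝ, E) (b q)}
    (hWd : MDifferentiableAt 𝓘(ℝ, E') 𝓘(ℝ, E) (fun q => dchart E (b p) (b q) (W q)) p)
    (hW : ∀ᶠ q in 𝓝 p, W q ∈ flag D i (b q)) {X : ∀ y : M, TangentSpace 𝓘(ℝ, E) y}
    (hX : IsLocalSection (flag D i) X (b p)) (hXW : X (b p) = W p)
    (u : TangentSpace 𝓘(ℝ, E') p) :
    vderiv (fun q => dchart E (b p) (b q) (W q)) p u -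
      vderiv (fun y => dchart E (b p) y (X y)) (b p) (mfderiv 𝓘(ℝ, E') 𝓘(ℝ, E) b p u) ∈
        (flag D i (b p)).map (dchart E (b p) (b p)).toLinearMap := by
  have hbp : b p ∈ (chartAt E (b p)).source := mem_chart_source E (b p)
  have hXd : MDifferentiableAt 𝓘(ℝ, E) 𝓘(ℝ, E) (fun y => dchart E (b p) y (X y)) (b p) :=
    (hX.contMDiffAt_dchart hbp).mdifferentiableAt (by simp)
  have hbd : MDifferentiableAt 𝓘(ℝ, E') 𝓘(ℝ, E) b p := hb.mdifferentiableAt (by simp)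
  have hXbd : MDifferentiableAt 𝓘(ℝ, E') 𝓘(ℝ, E) (fun q => dchart E (b p) (b q) (X (b q))) p :=
    hXd.comp p hbd
  rw [← vderiv_comp hXd hbd, ← vderiv_sub hWd hXbd]
  -- The difference of `W` and `X ∘ b` is a section of the pullback of `D^i` which vanishes at `p`.
  -- Regularity of `D` gives the constant rank, and local sections of `D^i` composed with `b` give
  -- the frame.
  obtain ⟨r, hr⟩ := hD.regular i hi
  refine vderiv_mem_of_eq_zero
    (K := fun q => (flag D i (b q)).map (dchart E (b p) (b q)).toLinearMap) ?_ ?_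
    (hWd.sub hXbd) ?_ ?_ u
  · filter_upwards [eventually_mem_chart_source (E := E) hb.continuous] with q hq
    rw [finrank_map_dchart hq, finrank_map_dchart hbp, hr, hr]
  · rintro _ ⟨v, hv, rfl⟩
    obtain ⟨Z, hZ, rfl⟩ := exists_isLocalSection_flag hD hv
    refine ⟨fun q => dchart E (b p) (b q) (Z (b q)), ?_, rfl, ?_⟩
    · exact ((hZ.contMDiffAt_dchart hbp).continuousAt.comp hb.continuous.continuousAt :)
    · filter_upwards [hb.continuous.continuousAt.eventually hZ.eventually_mem] with q hq
      exact ⟨_, hq, rfl⟩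
  · filter_upwards [hW, hb.continuous.continuousAt.eventually hX.eventually_mem] with q h1 h2
    exact ⟨W q - X (b q), sub_mem h1 h2, map_sub (dchart E (b p) (b q)) _ _⟩
  · simp [hXW]

lemma vderiv_chart_comp {x₀ : M} {q : N} (hb : MDifferentiableAt 𝓘(ℝ, E') 𝓘(ℝ, E) b q)
    (hq : b q ∈ (chartAt E x₀).source) (u : TangentSpace 𝓘(ℝ, E') q) :
    vderiv (fun q => extChartAt 𝓘(ℝ, E) x₀ (b q)) q u =
      dchart E x₀ (b q) (mfderiv 𝓘(ℝ, E') 𝓘(ℝ, E) b q u) :=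
  vderiv_comp (mdifferentiableAt_extChartAt hq) hb u

lemma vderiv_chart_comp_eventuallyEq (hb : ContMDiff 𝓘(ℝ, E') 𝓘(ℝ, E) ∞ b)
    (Y : ∀ q : N, TangentSpace 𝓘(ℝ, E') q) :
    (fun q => vderiv (fun q => extChartAt 𝓘(ℝ, E) (b p) (b q)) q (Y q)) =ᶠ[𝓝 p]
      fun q => dchart E (b p) (b q) (mfderiv 𝓘(ℝ, E') 𝓘(ℝ, E) b q (Y q)) := by
  filter_upwards [eventually_mem_chart_source (E := E) hb.continuous] with q hq
  exact vderiv_chart_comp (hb.mdifferentiableAt (by simp)) hq _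

lemma mdifferentiableAt_dchart_mfderiv (hb : ContMDiff 𝓘(ℝ, E') 𝓘(ℝ, E) ∞ b)
    {Y : ∀ q : N, TangentSpace 𝓘(ℝ, E') q}
    (hY : ContMDiffAt 𝓘(ℝ, E') 𝓘(ℝ, E').tangent ∞
      (fun q => (⟨q, Y q⟩ : TangentBundle 𝓘(ℝ, E') N)) p) :
    MDifferentiableAt 𝓘(ℝ, E') 𝓘(ℝ, E)
      (fun q => dchart E (b p) (b q) (mfderiv 𝓘(ℝ, E') 𝓘(ℝ, E) b q (Y q))) p := by
  have h1 : ContMDiffAt 𝓘(ℝ, E') 𝓘(ℝ, E).tangent ∞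
      (fun q => (⟨b q, mfderiv 𝓘(ℝ, E') 𝓘(ℝ, E) b q (Y q)⟩ : TangentBundle 𝓘(ℝ, E) M)) p :=
    (hb.contMDiff_tangentMap (m := ∞) (by simp)).contMDiffAt.comp p hY
  have h2 := (((trivializationAt E (TangentSpace 𝓘(ℝ, E)) (b p)).contMDiffAt_iff
    (IM := 𝓘(ℝ, E')) (IB := 𝓘(ℝ, E)) (n := ∞) (by
      rw [Bundle.Trivialization.mem_source]; simp)).1 h1).2
  refine (h2.congr_of_eventuallyEq ?_).mdifferentiableAt (by simp)
  filter_upwards [eventually_mem_chart_source (E := E) hb.continuous] with q hq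
  exact (trivializationAt_snd hq _).symm

lemma contMDiffAt_chart_comp (hb : ContMDiff 𝓘(ℝ, E') 𝓘(ℝ, E) ∞ b) :
    ContMDiffAt 𝓘(ℝ, E') 𝓘(ℝ, E) 2 (fun q => extChartAt 𝓘(ℝ, E) (b p) (b q)) p :=
  (contMDiffAt_extChartAt (I := 𝓘(ℝ, E)) (x := b p)).comp p
    (hb.contMDiffAt.of_le (WithTop.coe_le_coe.2 le_top))

/-- The bracket of two vector fields whose projections are sections of `D^{-1}` and of `D^i` is
computed modulo `D^i` by sections of `D^{-1}` and `D^i` on the base. -/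
lemma mfderiv_mlieBracket_sub_mem (hD : IsRegularDistribution D) {i : ℤ} (hi : i < 0)
    (hb : ContMDiff 𝓘(ℝ, E') 𝓘(ℝ, E) ∞ b) {Y₁ Y₂ : ∀ q : N, TangentSpace 𝓘(ℝ, E') q}
    (hY₁ : ContMDiffAt 𝓘(ℝ, E') 𝓘(ℝ, E').tangent ∞
      (fun q => (⟨q, Y₁ q⟩ : TangentBundle 𝓘(ℝ, E') N)) p)
    (hY₂ : ContMDiffAt 𝓘(ℝ, E') 𝓘(ℝ, E').tangent ∞
      (fun q => (⟨q, Y₂ q⟩ : TangentBundle 𝓘(ℝ, E') N)) p)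
    (h₁ : ∀ᶠ q in 𝓝 p, mfderiv 𝓘(ℝ, E') 𝓘(ℝ, E) b q (Y₁ q) ∈ flag D (-1) (b q))
    (h₂ : ∀ᶠ q in 𝓝 p, mfderiv 𝓘(ℝ, E') 𝓘(ℝ, E) b q (Y₂ q) ∈ flag D i (b q))
    {X₁ X₂ : ∀ y : M, TangentSpace 𝓘(ℝ, E) y}
    (hX₁ : IsLocalSection (flag D (-1)) X₁ (b p)) (hX₂ : IsLocalSection (flag D i) X₂ (b p))
    (e₁ : X₁ (b p) = mfderiv 𝓘(ℝ, E') 𝓘(ℝ, E) b p (Y₁ p))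
    (e₂ : X₂ (b p) = mfderiv 𝓘(ℝ, E') 𝓘(ℝ, E) b p (Y₂ p)) :
    mfderiv 𝓘(ℝ, E') 𝓘(ℝ, E) b p (mlieBracket 𝓘(ℝ, E') Y₁ Y₂ p) -
      mlieBracket 𝓘(ℝ, E) X₁ X₂ (b p) ∈ flag D i (b p) := by
  have : CompleteSpace E := FiniteDimensional.complete ℝ E
  have : CompleteSpace E' := FiniteDimensional.complete ℝ E'
  have hbp : b p ∈ (chartAt E (b p)).source := mem_chart_source E (b p)
  have hbd : ∀ q, MDifferentiableAt 𝓘(ℝ, E') 𝓘(ℝ, E) b q := fun q => hb.mdifferentiableAt (by simp)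
  have hκ : ContMDiffAt 𝓘(ℝ, E) 𝓘(ℝ, E) 2 (extChartAt 𝓘(ℝ, E) (b p)) (b p) :=
    contMDiffAt_extChartAt
  -- The bracket on `N` is tested on the chart composed with `b`, the bracket on `M` on the chart
  -- itself. The two results then differ only by errors of the kind treated in
  -- `vderiv_dchart_sub_mem`.
  have k1 := vderiv_apply_mlieBracket (contMDiffAt_chart_comp hb) (hY₁.mdifferentiableAt (by simp))
    (hY₂.mdifferentiableAt (by simp))
  have k2 := vderiv_apply_mlieBracket hκ hX₁.mdifferentiableAt hX₂.mdifferentiableAt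
  rw [vderiv_congr (vderiv_chart_comp_eventuallyEq hb Y₁),
    vderiv_congr (vderiv_chart_comp_eventuallyEq hb Y₂), vderiv_chart_comp (hbd p) hbp] at k1
  have m1 := vderiv_dchart_sub_mem hD (by decide) hb (mdifferentiableAt_dchart_mfderiv hb hY₁) h₁ hX₁ e₁ (Y₂ p)
  have m2 := vderiv_dchart_sub_mem hD hi hb (mdifferentiableAt_dchart_mfderiv hb hY₂) h₂ hX₂ e₂ (Y₁ p)
  -- The error from the first field lies in `D^{-1}`, which is contained in `D^i`.
  have m1' := Submodule.map_mono (f := (dchart E (b p) (b p)).toLinearMap)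
    (flag_anti (D := D) (show i ≤ -1 by omega) (b p)) m1
  obtain ⟨w, hw, hw'⟩ := sub_mem m2 m1'
  rw [← e₁, ← e₂] at hw'
  have : dchart E (b p) (b p) (mfderiv 𝓘(ℝ, E') 𝓘(ℝ, E) b p (mlieBracket 𝓘(ℝ, E') Y₁ Y₂ p) -
      mlieBracket 𝓘(ℝ, E) X₁ X₂ (b p)) = dchart E (b p) (b p) w := by
    rw [map_sub, k1]
    refine Eq.trans (congrArg (fun z => _ - z) k2) (Eq.trans ?_ hw'.symm)
    simp only [dchart]
    abel
  rw [(dchart_bijective hbp).1 this]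
  exact hw

end Projection

/-! ### Lifting vector fields through a submersion -/

section Lift

variable {E : Type*} [NormedAddCommGroup E] [NormedSpace ℝ E] [FiniteDimensional ℝ E]
  {M : Type*} [TopologicalSpace M] [ChartedSpace E M] [IsManifold 𝓘(ℝ, E) ∞ M]
  {E' : Type*} [NormedAddCommGroup E'] [NormedSpace ℝ E'] [FiniteDimensional ℝ E']
  {N : Type*} [TopologicalSpace N] [ChartedSpace E' N] [IsManifold 𝓘(ℝ, E') ∞ N]
  {b : N → M} {p : N}

/-- A smooth vector field along a submersion lifts to a smooth vector field with a prescribed value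
at a point. -/
lemma exists_lift_of_surjective (hb : ContMDiff 𝓘(ℝ, E') 𝓘(ℝ, E) ∞ b)
    (hsurj : Function.Surjective (mfderiv 𝓘(ℝ, E') 𝓘(ℝ, E) b p))
    {W : ∀ q, TangentSpace 𝓘(ℝ, E) (b q)} {U : Set N} (hU : IsOpen U) (hpU : p ∈ U)
    (hW : ContMDiffOn 𝓘(ℝ, E') 𝓘(ℝ, E).tangent ∞
      (fun q => (⟨b q, W q⟩ : TangentBundle 𝓘(ℝ, E) M)) U)
    {u : TangentSpace 𝓘(ℝ, E') p} (hu : mfderiv 𝓘(ℝ, E') 𝓘(ℝ, E) b p u = W p) :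
    ∃ (Y : ∀ q : N, TangentSpace 𝓘(ℝ, E') q) (U' : Set N), IsOpen U' ∧ p ∈ U' ∧ U' ⊆ U ∧
      ContMDiffOn 𝓘(ℝ, E') 𝓘(ℝ, E').tangent ∞
        (fun q => (⟨q, Y q⟩ : TangentBundle 𝓘(ℝ, E') N)) U' ∧
      (∀ q ∈ U', mfderiv 𝓘(ℝ, E') 𝓘(ℝ, E) b q (Y q) = W q) ∧ Y p = u := by
  have : CompleteSpace E := FiniteDimensional.complete ℝ E
  have : CompleteSpace E' := FiniteDimensional.complete ℝ E'
  have hbd : ∀ q, MDifferentiableAt 𝓘(ℝ, E') 𝓘(ℝ, E) b q := fun q => hb.mdifferentiableAt (by simp)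
  set φ := extChartAt 𝓘(ℝ, E') p with hφ
  set κ := extChartAt 𝓘(ℝ, E) (b p) with hκ
  have hbp : b p ∈ (chartAt E (b p)).source := mem_chart_source E (b p)
  set S : Set N := U ∩ ((chartAt E' p).source ∩ b ⁻¹' (chartAt E (b p)).source) with hS
  have hSo : IsOpen S := hU.inter ((chartAt E' p).open_source.inter
    ((chartAt E (b p)).open_source.preimage hb.continuous))
  have hpS : p ∈ S := ⟨hpU, mem_chart_source E' p, hbp⟩
  have hφs : φ.source = (chartAt E' p).source := extChartAt_source _ _
  -- the map `b` in charts
  set g : E' → E := fun e => κ (b (φ.symm e)) with hg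
  set O : Set E' := φ.target ∩ φ.symm ⁻¹' S with hO
  have hOo : IsOpen O :=
    (continuousOn_extChartAt_symm p).isOpen_inter_preimage (isOpen_extChartAt_target p) hSo
  have hgO : ContDiffOn ℝ ∞ g O := by
    rw [← contMDiffOn_iff_contDiffOn]
    have h1 : ContMDiffOn 𝓘(ℝ, E') 𝓘(ℝ, E') ∞ φ.symm O :=
      (contMDiffOn_extChartAt_symm p).mono Set.inter_subset_left
    have h2 : ContMDiffOn 𝓘(ℝ, E) 𝓘(ℝ, E) ∞ κ (chartAt E (b p)).source :=
      contMDiffOn_extChartAt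
    exact h2.comp (hb.comp_contMDiffOn h1) fun e he => he.2.2.2
  have hφO : Set.MapsTo φ S O := fun q hq => by
    have hq' : q ∈ φ.source := by rw [hφs]; exact hq.2.1
    refine ⟨φ.map_source hq', ?_⟩
    rw [Set.mem_preimage, φ.left_inv hq']
    exact hq
  set T : N → E' →L[ℝ] E := fun q => fderiv ℝ g (φ q) with hT
  have hTs : ContMDiffOn 𝓘(ℝ, E') 𝓘(ℝ, E' →L[ℝ] E) ∞ T S := by
    have h1 : ContMDiffOn 𝓘(ℝ, E') 𝓘(ℝ, E' →L[ℝ] E) ∞ (fderiv ℝ g) O :=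
      (hgO.fderiv_of_isOpen (m := ∞) hOo (by simp)).contMDiffOn
    have h2 : ContMDiffOn 𝓘(ℝ, E') 𝓘(ℝ, E') ∞ φ S :=
      (contMDiffOn_extChartAt (x := p)).mono fun q hq => hq.2.1
    exact h1.comp h2 hφO
  have hTb : ∀ q ∈ S, ∀ v : TangentSpace 𝓘(ℝ, E') q,
      T q (dchart E' p q v) = dchart E (b p) (b q) (mfderiv 𝓘(ℝ, E') 𝓘(ℝ, E) b q v) := by
    intro q hq v
    rw [← vderiv_chart_comp (hbd q) hq.2.2]
    refine (vderiv_eq_fderiv_comp_dchart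
      ((hgO.contDiffAt (hOo.mem_nhds (hφO hq))).differentiableAt (by simp)) hq.2.1 ?_ v).symm
    filter_upwards [(chartAt E' p).open_source.mem_nhds hq.2.1] with q' hq'
    rw [← hφs] at hq'
    simp only [hg, Function.comp_apply]
    rw [φ.left_inv hq']
  have hTsurj : Function.Surjective (T p) := fun e => by
    obtain ⟨v, hv⟩ := (dchart_bijective hbp).2 e
    obtain ⟨v', rfl⟩ := hsurj v
    exact ⟨_, (hTb p hpS v').trans hv⟩
  -- `T q` is `b_*` in coordinates. A right inverse `R` at the single point `p` suffices: `T q ∘ R`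
  -- stays invertible near `p`, so `R ∘ (T q ∘ R)⁻¹` is a smooth family of right inverses.
  obtain ⟨R', hR'⟩ := (T p).toLinearMap.exists_rightInverse_of_surjective
    (LinearMap.range_eq_top.2 hTsurj)
  set R : E →L[ℝ] E' := LinearMap.toContinuousLinearMap R' with hR
  set C : N → E →L[ℝ] E := fun q => (T q).comp R with hC
  have hCp : C p = 1 := by
    ext1 e
    exact congrArg (fun L : E →ₗ[ℝ] E => L e) hR'
  have hCs : ContMDiffOn 𝓘(ℝ, E') 𝓘(ℝ, E →L[ℝ] E) ∞ C S := hTs.clm_comp contMDiffOn_const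
  set S' : Set N := S ∩ C ⁻¹' {A | IsUnit A} with hS'
  have hS'o : IsOpen S' := hCs.continuousOn.isOpen_inter_preimage hSo Units.isOpen
  have hpS' : p ∈ S' := ⟨hpS, by rw [Set.mem_preimage, hCp]; exact isUnit_one⟩
  set w : N → E := fun q => dchart E (b p) (b q) (W q) with hw
  have hws : ContMDiffOn 𝓘(ℝ, E') 𝓘(ℝ, E) ∞ w S :=
    (contMDiffOn_along_iff hb.contMDiffOn (fun q hq => hq.2.2) W).1
      (hW.mono Set.inter_subset_left)
  set u' : E' := dchart E' p p u with hu'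
  -- The constant vector `u'` is corrected by a preimage of its error. The error vanishes at `p`,
  -- which keeps the prescribed value there.
  set y : N → E' := fun q => u' + R (Ring.inverse (C q) (w q - T q u')) with hy
  have hys : ContMDiffOn 𝓘(ℝ, E') 𝓘(ℝ, E') ∞ y S' := by
    have h1 : ContMDiffOn 𝓘(ℝ, E') 𝓘(ℝ, E →L[ℝ] E) ∞ (fun q => Ring.inverse (C q)) S' := by
      intro q hq
      obtain ⟨A, hA⟩ := hq.2
      have h2 : ContMDiffAt 𝓘(ℝ, E →L[ℝ] E) 𝓘(ℝ, E →L[ℝ] E) ∞ Ring.inverse (C q) := by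
        rw [← hA]
        exact (contDiffAt_ringInverse ℝ A).contMDiffAt
      exact h2.comp_contMDiffWithinAt q ((hCs q hq.1).mono Set.inter_subset_left)
    have h3 : ContMDiffOn 𝓘(ℝ, E') 𝓘(ℝ, E) ∞ (fun q => w q - T q u') S' :=
      (hws.sub (hTs.clm_apply contMDiffOn_const)).mono Set.inter_subset_left
    exact contMDiffOn_const.add ((contMDiffOn_const (c := R)).clm_apply (h1.clm_apply h3))
  have hex : ∀ q, ∃ v : TangentSpace 𝓘(ℝ, E') q, q ∈ S → dchart E' p q v = y q := fun q => by
    by_cases hq : q ∈ S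
    · obtain ⟨v, hv⟩ := (dchart_bijective hq.2.1).2 (y q)
      exact ⟨v, fun _ => hv⟩
    · exact ⟨0, fun h => absurd h hq⟩
  choose Y hY using hex
  refine ⟨Y, S', hS'o, hpS', fun q hq => hq.1.1, ?_, fun q hq => ?_, ?_⟩
  · refine (contMDiffOn_along_iff (b := id) contMDiffOn_id (fun q hq => hq.1.2.1) Y).2 ?_
    exact hys.congr fun q hq => hY q hq.1
  · refine (dchart_bijective hq.1.2.2).1 ?_
    have h1 : C q (Ring.inverse (C q) (w q - T q u')) = w q - T q u' :=
      congrArg (fun L : E →L[ℝ] E => L (w q - T q u')) (Ring.mul_inverse_cancel _ hq.2)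
    rw [← hTb q hq.1, hY q hq.1]
    refine (map_add (T q) _ _).trans ?_
    refine (congrArg (T q u' + ·) h1).trans ?_
    abel
  · refine (dchart_bijective (mem_chart_source E' p)).1 ?_
    have h1 : w p - T p u' = 0 := by
      rw [hu', hTb p hpS, hu, sub_self]
    rw [hY p hpS]
    simp only [hy, h1, map_zero, add_zero]
    rfl

end Lift

namespace ConstantTypeStructure

/-! ### The soldering form and brackets of sections of `D₀^{-1}` and `D₀^i` -/

section Brackets

variable {𝔪 : Type*} [LieRing 𝔪] [LieAlgebra ℝ 𝔪] [FiniteDimensional ℝ 𝔪]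
  {𝔤 : FundamentalGrading 𝔪}
  {E : Type*} [NormedAddCommGroup E] [NormedSpace ℝ E]
  {M : Type*} [TopologicalSpace M] [ChartedSpace E M] [IsManifold 𝓘(ℝ, E) ∞ M]
  {D : ∀ x : M, Submodule ℝ (TangentSpace 𝓘(ℝ, E) x)}
  {F : Type*} [NormedAddCommGroup F] [NormedSpace ℝ F]
  {G : Type*} [TopologicalSpace G] [ChartedSpace F G] [Group G] [LieGroup 𝓘(ℝ, F) ∞ G]
  {ρ : LieSubgroup 𝔤 F G}
  {E' : Type*} [NormedAddCommGroup E'] [NormedSpace ℝ E']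
  {P : Type*} [TopologicalSpace P] [ChartedSpace E' P] [IsManifold 𝓘(ℝ, E') ∞ P]
  (S : ConstantTypeStructure D ρ E' P)

/-- `u ∈ D₀^i(λ)` and `ω₀^i(u) = v`. -/
def HasSolder (i : ℤ) (p : P) (u : TangentSpace 𝓘(ℝ, E') p) (v : 𝔪) : Prop :=
  ∃ h : u ∈ S.filt i p, (S.solder i p ⟨u, h⟩ : 𝔪) = v

variable {S} {i : ℤ} {p : P}

lemma HasSolder.unique {u : TangentSpace 𝓘(ℝ, E') p} {v v' : 𝔪} (h : S.HasSolder i p u v)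
    (h' : S.HasSolder i p u v') : v = v' := by
  obtain ⟨h, rfl⟩ := h
  obtain ⟨h', rfl⟩ := h'
  rfl

lemma HasSolder.add {u u' : TangentSpace 𝓘(ℝ, E') p} {v v' : 𝔪} (h : S.HasSolder i p u v)
    (h' : S.HasSolder i p u' v') : S.HasSolder i p (u + u') (v + v') := by
  obtain ⟨h, rfl⟩ := h
  obtain ⟨h', rfl⟩ := h'
  exact ⟨add_mem h h', congrArg Subtype.val (map_add (S.solder i p) ⟨u, h⟩ ⟨u', h'⟩)⟩

lemma HasSolder.neg {u : TangentSpace 𝓘(ℝ, E') p} {v : 𝔪} (h : S.HasSolder i p u v) :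
    S.HasSolder i p (-u) (-v) := by
  obtain ⟨h, rfl⟩ := h
  exact ⟨neg_mem h, congrArg Subtype.val (map_neg (S.solder i p) ⟨u, h⟩)⟩

lemma HasSolder.sub {u u' : TangentSpace 𝓘(ℝ, E') p} {v v' : 𝔪} (h : S.HasSolder i p u v)
    (h' : S.HasSolder i p u' v') : S.HasSolder i p (u - u') (v - v') := by
  rw [sub_eq_add_neg, sub_eq_add_neg]
  exact h.add h'.neg

lemma mem_filt_iff (hi : i ≤ 0) {u : TangentSpace 𝓘(ℝ, E') p} :
    u ∈ S.filt i p ↔ S.dproj p u ∈ flag D i (S.proj p) := by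
  rw [filt, if_pos hi]
  rfl

lemma hasSolder_iff (hi : i ≤ 0) {u : TangentSpace 𝓘(ℝ, E') p} {v : 𝔤.piece i} :
    S.HasSolder i p u v ↔ ∃ h : S.dproj p u ∈ flag D i (S.proj p),
      symbolMk D i (S.proj p) ⟨S.dproj p u, h⟩ = (S.frame p).toEquiv i v := by
  constructor
  · rintro ⟨h, hv⟩
    refine ⟨(mem_filt_iff hi).1 h, ?_⟩
    rw [← LinearEquiv.symm_apply_eq]
    exact Subtype.ext hv
  · rintro ⟨h, hv⟩
    refine ⟨(mem_filt_iff hi).2 h, congrArg Subtype.val ?_⟩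
    rw [← LinearEquiv.symm_apply_eq] at hv
    exact hv

/-- Soldering values are recorded in `𝔪`, so that a degree such as `-1 + (i + 1)` can be rewritten
without casts; the degree of the value is recovered here. -/
lemma HasSolder.mem_piece {u : TangentSpace 𝓘(ℝ, E') p} {v : 𝔪} (h : S.HasSolder i p u v) :
    v ∈ 𝔤.piece i := by
  obtain ⟨h, rfl⟩ := h
  exact Subtype.mem _

lemma symbolMk_eq_iff {x : M} {a b : TangentSpace 𝓘(ℝ, E) x} (ha : a ∈ flag D i x)
    (hb : b ∈ flag D i x) :
    symbolMk D i x ⟨a, ha⟩ = symbolMk D i x ⟨b, hb⟩ ↔ a - b ∈ flag D (i + 1) x :=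
  Submodule.Quotient.eq _

/-- Both projections represent `φ v` modulo `D^{i+1}`. This is why differences of adapted fields
gain one step in the filtration. -/
lemma HasSolder.sub_mem_filt (hi : i < 0) {u u' : TangentSpace 𝓘(ℝ, E') p} {v : 𝔪}
    (h : S.HasSolder i p u v) (h' : S.HasSolder i p u' v) : u - u' ∈ S.filt (i + 1) p := by
  have hv := h.mem_piece
  obtain ⟨h, e⟩ := (hasSolder_iff hi.le (v := ⟨v, hv⟩)).1 h
  obtain ⟨h', e'⟩ := (hasSolder_iff hi.le (v := ⟨v, hv⟩)).1 h'
  rw [mem_filt_iff (by omega), map_sub]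
  exact (symbolMk_eq_iff h h').1 (e.trans e'.symm)

lemma contMDiff_proj (S : ConstantTypeStructure D ρ E' P) :
    ContMDiff 𝓘(ℝ, E') 𝓘(ℝ, E) ∞ S.proj := S.smooth_proj

lemma eventually_dproj_mem {Y : ∀ q : P, TangentSpace 𝓘(ℝ, E') q}
    (hY : IsLocalSection (S.filt i) Y p) :
    ∀ᶠ q in 𝓝 p, mfderiv 𝓘(ℝ, E') 𝓘(ℝ, E) S.proj q (Y q) ∈ flag D i (S.proj q) := by
  filter_upwards [hY.eventually_mem] with q hq using S.dproj_mem hq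

variable [FiniteDimensional ℝ E] [FiniteDimensional ℝ E']

/-- The bracket of sections of `D₀^{-1}` and `D₀^i` induces the bracket of `𝔪`. -/
lemma HasSolder.mlieBracket (hD : IsRegularDistribution D) (hi : i < 0)
    {Y₁ Y₂ : ∀ q : P, TangentSpace 𝓘(ℝ, E') q} (hY₁ : IsLocalSection (S.filt (-1)) Y₁ p)
    (hY₂ : IsLocalSection (S.filt i) Y₂ p) {v₁ v₂ : 𝔪} (h₁ : S.HasSolder (-1) p (Y₁ p) v₁)
    (h₂ : S.HasSolder i p (Y₂ p) v₂) :
    S.HasSolder (-1 + i) p (VectorField.mlieBracket 𝓘(ℝ, E') Y₁ Y₂ p) ⁅v₁, v₂⁆ := by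
  have : CompleteSpace E := FiniteDimensional.complete ℝ E
  have hv₁ := h₁.mem_piece
  have hv₂ := h₂.mem_piece
  obtain ⟨m₁, e₁⟩ := (hasSolder_iff (by decide) (v := ⟨v₁, hv₁⟩)).1 h₁
  obtain ⟨m₂, e₂⟩ := (hasSolder_iff hi.le (v := ⟨v₂, hv₂⟩)).1 h₂
  -- These sections compute the bracket of `φ v₁` and `φ v₂` in the symbol. `X₁` agrees at the point
  -- with the projection of `Y₁`, because `D^0 = 0`, but `X₂` agrees with that of `Y₂` only modulo
  -- `D^{i+1}`.
  obtain ⟨X₁, X₂, hX₁, hX₂, ⟨n₁, f₁⟩, ⟨n₂, f₂⟩, hb, eb⟩ :=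
    (S.frame p).map_lie (-1) i (by decide) hi ⟨v₁, hv₁⟩ ⟨v₂, hv₂⟩
  have g₁ : X₁ (S.proj p) = S.dproj p (Y₁ p) := by
    have := (symbolMk_eq_iff n₁ m₁).1 (f₁.trans e₁.symm)
    rw [show (-1 : ℤ) + 1 = 0 from rfl, flag_zero, Submodule.mem_bot] at this
    exact sub_eq_zero.1 this
  -- `X₃` is a section of `D^{i+1}` that repairs the value of `X₂`. Its bracket with `X₁` lies in
  -- `D^i`, so it does not affect the class in `D^{i-1} / D^i`.
  obtain ⟨X₃, hX₃, g₃⟩ := exists_isLocalSection_flag hD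
    ((symbolMk_eq_iff m₂ n₂).1 (e₂.trans f₂.symm))
  have hX₃' : IsLocalSection (flag D i) X₃ (S.proj p) := hX₃.mono fun y => flag_succ_le D i y
  have k1 := mfderiv_mlieBracket_sub_mem hD hi S.contMDiff_proj hY₁.contMDiffAt hY₂.contMDiffAt
    (eventually_dproj_mem hY₁) (eventually_dproj_mem hY₂) hX₁ (hX₂.add hX₃') g₁
    (by rw [Pi.add_apply, g₃]; exact add_sub_cancel _ _)
  rw [mlieBracket_add_right hX₂.mdifferentiableAt hX₃'.mdifferentiableAt] at k1
  have k2 := hX₁.mlieBracket_right_mem_flag (by omega) hX₃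
  rw [show -1 + (i + 1) = i by ring] at k2
  have k3 : S.dproj p (VectorField.mlieBracket 𝓘(ℝ, E') Y₁ Y₂ p) -
      VectorField.mlieBracket 𝓘(ℝ, E) X₁ X₂ (S.proj p) ∈ flag D (-1 + i + 1) (S.proj p) := by
    rw [show -1 + i + 1 = i by ring]
    have := add_mem k1 k2
    rw [← sub_sub, sub_add_cancel] at this
    exact this
  have k4 : S.dproj p (VectorField.mlieBracket 𝓘(ℝ, E') Y₁ Y₂ p) ∈ flag D (-1 + i) (S.proj p) := by
    have := add_mem (flag_succ_le D _ _ k3) hb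
    rwa [sub_add_cancel] at this
  rw [show ⁅v₁, v₂⁆ = ((⟨⁅v₁, v₂⁆, 𝔤.lie_mem hv₁ hv₂⟩ : 𝔤.piece (-1 + i)) : 𝔪) from rfl,
    hasSolder_iff (by omega)]
  exact ⟨k4, ((symbolMk_eq_iff k4 hb).2 k3).trans eb⟩

end Brackets

end ConstantTypeStructure

namespace ConstantTypeStructure

/-! ### Brackets with vertical fields -/

section Vertical

variable {𝔪 : Type*} [LieRing 𝔪] [LieAlgebra ℝ 𝔪] [FiniteDimensional ℝ 𝔪]
  {𝔤 : FundamentalGrading 𝔪}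
  {E : Type*} [NormedAddCommGroup E] [NormedSpace ℝ E]
  {M : Type*} [TopologicalSpace M] [ChartedSpace E M] [IsManifold 𝓘(ℝ, E) ∞ M]
  {D : ∀ x : M, Submodule ℝ (TangentSpace 𝓘(ℝ, E) x)}
  {F : Type*} [NormedAddCommGroup F] [NormedSpace ℝ F]
  {G : Type*} [TopologicalSpace G] [ChartedSpace F G] [Group G] [LieGroup 𝓘(ℝ, F) ∞ G]
  {ρ : LieSubgroup 𝔤 F G}
  {E' : Type*} [NormedAddCommGroup E'] [NormedSpace ℝ E']
  {P : Type*} [TopologicalSpace P] [ChartedSpace E' P] [IsManifold 𝓘(ℝ, E') ∞ P]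
  {S : ConstantTypeStructure D ρ E' P} {i : ℤ} {p : P}

/-- The projections to `M` of the vectors `u` at the points of the fibre of `P` with
`ω₀^i(u) = v` transform by the structure group. -/
lemma exists_dchart_eq_of_hasSolder_act (hi : i ≤ 0) {g : G} {v : 𝔤.piece i} {x₀ : M}
    {u : TangentSpace 𝓘(ℝ, E') (S.act p g)} (hu : S.HasSolder i (S.act p g) u v) :
    ∃ w : flag D i (S.proj p),
      dchart E x₀ (S.proj (S.act p g)) (S.dproj (S.act p g) u) = dchart E x₀ (S.proj p) w ∧
      symbolMk D i (S.proj p) w = (S.frame p).toEquiv i (onPiece (ρ.incl g) i v) := by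
  -- The base points of `S.act p g` and `p` are equal only propositionally. With the frame as a
  -- variable `f`, equivariance can be substituted in the dependent types.
  have key : ∀ f : FullFrame 𝔤 D, f = (S.toFrame p).act (ρ.incl g) → ∀ e : E,
      (∃ w : flag D i f.1, e = dchart E x₀ f.1 w ∧ symbolMk D i f.1 w = f.2.toEquiv i v) →
      ∃ w : flag D i (S.proj p), e = dchart E x₀ (S.proj p) w ∧
        symbolMk D i (S.proj p) w = (S.frame p).toEquiv i (onPiece (ρ.incl g) i v) := by
    rintro _ rfl e ⟨w, hw, hw'⟩
    exact ⟨w, hw, hw'⟩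
  obtain ⟨h, e⟩ := (hasSolder_iff hi).1 hu
  exact key _ (S.toFrame_act p g) _ ⟨⟨_, h⟩, rfl, e⟩

lemma contMDiff_act_left (S : ConstantTypeStructure D ρ E' P) (p : P) :
    ContMDiff 𝓘(ℝ, F) 𝓘(ℝ, E') ∞ (fun g : G => S.act p g) :=
  S.smooth_act.comp (contMDiff_const.prodMk contMDiff_id)

/-- The chain rule along the orbit; the content of `key` is the transport from `S.act p 1` to `p`.
-/
lemma vderiv_comp_act {V : Type*} [NormedAddCommGroup V] [NormedSpace ℝ V] {w : P → V}
    (hw : MDifferentiableAt 𝓘(ℝ, E') 𝓘(ℝ, V) w p) (X : TangentSpace 𝓘(ℝ, F) (1 : G)) :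
    vderiv (fun g : G => w (S.act p g)) 1 X = vderiv w p (S.vert p X) := by
  have key : ∀ q, q = p → MDifferentiableAt 𝓘(ℝ, E') 𝓘(ℝ, V) w q ∧
      ∀ u : E', (vderiv w q : E' →L[ℝ] V) u = (vderiv w p : E' →L[ℝ] V) u := by
    rintro _ rfl
    exact ⟨hw, fun _ => rfl⟩
  obtain ⟨h1, h2⟩ := key _ (S.act_one p)
  exact (vderiv_comp h1 (S.mdifferentiableAt_act p 1) X).trans (h2 _)

variable [FiniteDimensional ℝ E] [FiniteDimensional ℝ E']

/-- The bracket of a vertical vector field with a vector field on which the soldering form is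
constant is given by the action of `𝔤^0` on `𝔪`. -/
lemma HasSolder.mlieBracket_vert (hi : i < 0) {Z Y : ∀ q : P, TangentSpace 𝓘(ℝ, E') q}
    (hZ : ContMDiffAt 𝓘(ℝ, E') 𝓘(ℝ, E').tangent ∞
      (fun q => (⟨q, Z q⟩ : TangentBundle 𝓘(ℝ, E') P)) p)
    (hY : ContMDiffAt 𝓘(ℝ, E') 𝓘(ℝ, E').tangent ∞
      (fun q => (⟨q, Y q⟩ : TangentBundle 𝓘(ℝ, E') P)) p)
    (hZv : ∀ᶠ q in 𝓝 p, S.dproj q (Z q) = 0) {X : TangentSpace 𝓘(ℝ, F) (1 : G)}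
    (hZp : Z p = S.vert p X) {v : 𝔪} (hYv : ∀ᶠ q in 𝓝 p, S.HasSolder i q (Y q) v) :
    S.HasSolder i p (VectorField.mlieBracket 𝓘(ℝ, E') Z Y p) (ρ.toDer X v) := by
  have : CompleteSpace E' := FiniteDimensional.complete ℝ E'
  set x := S.proj p with hx
  have hv := hYv.self_of_nhds.mem_piece
  have hxs : x ∈ (chartAt E x).source := mem_chart_source E x
  have hproj := S.contMDiff_proj
  -- the bracket in terms of derivatives along the fibre
  set w : P → E := fun q => dchart E x (S.proj q) (S.dproj q (Y q)) with hw
  have hwd : MDifferentiableAt 𝓘(ℝ, E') 𝓘(ℝ, E) w p := mdifferentiableAt_dchart_mfderiv hproj hY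
  have hbr : dchart E x x (S.dproj p (VectorField.mlieBracket 𝓘(ℝ, E') Z Y p)) =
      vderiv w p (Z p) := by
    have k := vderiv_apply_mlieBracket (contMDiffAt_chart_comp hproj)
      (hZ.mdifferentiableAt (by simp)) (hY.mdifferentiableAt (by simp))
    rw [vderiv_chart_comp (hproj.mdifferentiableAt (by simp)) hxs,
      vderiv_congr (vderiv_chart_comp_eventuallyEq hproj Y),
      vderiv_congr (vderiv_chart_comp_eventuallyEq hproj Z)] at k
    -- A vertical field annihilates functions pulled back from `M`, so only one term of the
    -- commutator survives.
    have k0 : (fun q => dchart E x (S.proj q) (mfderiv 𝓘(ℝ, E') 𝓘(ℝ, E) S.proj q (Z q))) =ᶠ[𝓝 p]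
        fun _ => (0 : E) := by
      filter_upwards [hZv] with q hq
      exact (congrArg (dchart E x (S.proj q)) hq).trans (map_zero _)
    rw [vderiv_congr k0, vderiv_const, sub_zero] at k
    exact k
  set a : G → E := fun g => w (S.act p g) with ha
  have had : MDifferentiableAt 𝓘(ℝ, F) 𝓘(ℝ, E) a 1 := by
    have h1 : MDifferentiableAt 𝓘(ℝ, E') 𝓘(ℝ, E) w (S.act p 1) := by rwa [S.act_one]
    exact h1.comp (1 : G) (S.mdifferentiableAt_act p 1)
  have hbr' : dchart E x x (S.dproj p (VectorField.mlieBracket 𝓘(ℝ, E') Z Y p)) =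
      vderiv a 1 X := by
    rw [hbr, hZp, ← vderiv_comp_act hwd]
  -- Constancy of the soldering value near `p` and equivariance: the projection of `Y` at `p · g`
  -- represents `φ(g v)`, always in the tangent space at `x`.
  have hfib : ∀ᶠ g in 𝓝 (1 : G), ∃ u : flag D i x, a g = dchart E x x u ∧
      symbolMk D i x u = (S.frame p).toEquiv i (onPiece (ρ.incl g) i ⟨v, hv⟩) := by
    have hc : Filter.Tendsto (fun g : G => S.act p g) (𝓝 1) (𝓝 p) := by
      have := (S.contMDiff_act_left p).continuous.continuousAt (x := (1 : G))
      rwa [ContinuousAt, S.act_one] at this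
    filter_upwards [hc.eventually hYv] with g hg
    exact exists_dchart_eq_of_hasSolder_act hi.le (v := ⟨v, hv⟩) hg
  -- the derivative is tangent to `D^i`
  have hmem : vderiv a 1 X ∈ (flag D i x).map (dchart E x x).toLinearMap := by
    have hconst : MDifferentiableAt 𝓘(ℝ, F) 𝓘(ℝ, E) (fun _ : G => a 1) 1 := mdifferentiableAt_const
    have h1 : vderiv (fun g => a g - a 1) 1 X ∈ (flag D i x).map (dchart E x x).toLinearMap := by
      refine vderiv_mem_of_eq_zero
        (K := fun _ : G => (flag D i x).map (dchart E x x).toLinearMap)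
        (Filter.Eventually.of_forall fun _ => rfl)
        (fun e he => ⟨fun _ => e, continuousAt_const, rfl, Filter.Eventually.of_forall fun _ => he⟩)
        (had.sub hconst) ?_ (sub_self _) X
      filter_upwards [hfib] with g hg
      obtain ⟨u, hu, -⟩ := hg
      obtain ⟨u₁, hu₁, -⟩ := hfib.self_of_nhds
      exact sub_mem ⟨u, u.2, hu.symm⟩ ⟨u₁, u₁.2, hu₁.symm⟩
    rwa [vderiv_sub had hconst, vderiv_const, sub_zero] at h1
  obtain ⟨z, hz, hz'⟩ := hmem
  have hzb : S.dproj p (VectorField.mlieBracket 𝓘(ℝ, E') Z Y p) = z :=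
    (dchart_bijective hxs).1 (hbr'.trans hz'.symm)
  -- the value of the soldering form
  obtain ⟨Φ, hΦ⟩ := LinearMap.exists_extend ((𝔤.piece i).subtype ∘ₗ
    ((S.frame p).toEquiv i).symm.toLinearMap ∘ₗ symbolMk D i x)
  have hΦ' : ∀ u : flag D i x,
      Φ u = (((S.frame p).toEquiv i).symm (symbolMk D i x u) : 𝔤.piece i) := fun u =>
    congrArg (fun L : flag D i x →ₗ[ℝ] 𝔪 => L u) hΦ
  set κ := LinearEquiv.ofBijective (dchart E x x).toLinearMap (dchart_bijective hxs) with hκ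
  have hval : Φ z = ρ.diffEnd X v := by
    refine LieSubgroup.ext_dual fun ℓ => ?_
    set L : E →L[ℝ] ℝ := LinearMap.toContinuousLinearMap (ℓ ∘ₗ Φ ∘ₗ κ.symm.toLinearMap) with hL
    have hLκ : ∀ u, L (dchart E x x u) = ℓ (Φ u) := fun u =>
      congrArg (fun e => ℓ (Φ e)) (κ.symm_apply_apply u)
    rw [ρ.apply_diffEnd, ← hLκ]
    refine (congrArg L hz').trans ?_
    rw [← vderiv_clm_comp L had]
    -- Composed with `L`, the function `a` becomes the matrix coefficient whose derivative at `1`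
    -- defines `diffEnd`.
    refine vderiv_congr (g := fun g : G => ℓ ((ρ.incl g : 𝔪 ≃ₗ[ℝ] 𝔪) v)) ?_ X
    filter_upwards [hfib] with g hg
    obtain ⟨u, hu, hu'⟩ := hg
    rw [hu, hLκ, hΦ', hu', LinearEquiv.symm_apply_apply]
    rfl
  refine ⟨(mem_filt_iff hi.le).2 (hzb ▸ hz), ?_⟩
  refine Eq.trans ?_ hval
  refine Eq.trans ?_ (hΦ' ⟨z, hz⟩).symm
  exact congrArg (fun u => (((S.frame p).toEquiv i).symm (symbolMk D i x u) : 𝔪))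
    (Subtype.ext hzb)

end Vertical

end ConstantTypeStructure

/-! ### Brackets of `𝔪 ⊕ Der 𝔪` -/

lemma lie_inDer_inM {𝔪 : Type*} [LieRing 𝔪] [LieAlgebra ℝ 𝔪] (δ : LieDerivation ℝ 𝔪 𝔪) (v : 𝔪) :
    ⁅inDer δ, (inM v : ExtAlgebra 𝔪)⁆ = inM (δ v) := by
  ext <;> simp [inDer, inM]

lemma lie_inM_inDer {𝔪 : Type*} [LieRing 𝔪] [LieAlgebra ℝ 𝔪] (δ : LieDerivation ℝ 𝔪 𝔪) (v : 𝔪) :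
    ⁅(inM v : ExtAlgebra 𝔪), inDer δ⁆ = -inM (δ v) := by
  rw [← lie_skew, lie_inDer_inM]

lemma lie_inM_inM {𝔪 : Type*} [LieRing 𝔪] [LieAlgebra ℝ 𝔪] (v w : 𝔪) :
    ⁅(inM v : ExtAlgebra 𝔪), inM w⁆ = inM ⁅v, w⁆ :=
  (LieHom.map_lie _ v w).symm

namespace ConstantTypeStructure

/-! ### The projections `pr^ℋ` and the map `f` on representatives -/

namespace ComplTuple

variable {𝔪 : Type*} [LieRing 𝔪] [LieAlgebra ℝ 𝔪] [FiniteDimensional ℝ 𝔪]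
  {𝔤 : FundamentalGrading 𝔪}
  {E : Type*} [NormedAddCommGroup E] [NormedSpace ℝ E]
  {M : Type*} [TopologicalSpace M] [ChartedSpace E M] [IsManifold 𝓘(ℝ, E) ∞ M]
  {D : ∀ x : M, Submodule ℝ (TangentSpace 𝓘(ℝ, E) x)}
  {F : Type*} [NormedAddCommGroup F] [NormedSpace ℝ F]
  {G : Type*} [TopologicalSpace G] [ChartedSpace F G] [Group G] [LieGroup 𝓘(ℝ, F) ∞ G]
  {ρ : LieSubgroup 𝔤 F G}
  {E' : Type*} [NormedAddCommGroup E'] [NormedSpace ℝ E']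
  {P : Type*} [TopologicalSpace P] [ChartedSpace E' P] [IsManifold 𝓘(ℝ, E') ∞ P]
  {S : ConstantTypeStructure D ρ E' P} {p : P}

/-- `t ∈ D₀^i(λ)` represents `φ^ℋ(v)` modulo `D₀^{i+2}(λ)`. -/
def IsLift (H : S.ComplTuple p) (i : ℤ) (t : TangentSpace 𝓘(ℝ, E') p) (v : 𝔪) : Prop :=
  ∃ (hi : i < 0) (h : t ∈ S.filt i p) (hv : v ∈ 𝔤.piece i),
    S.mkTwo i p ⟨t, h⟩ = H.lift i hi ⟨v, hv⟩

variable {H H' : S.ComplTuple p} {i : ℤ}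

lemma exists_isLift (H : S.ComplTuple p) (hi : i < 0) (v : 𝔤.piece i) : ∃ t, H.IsLift i t v := by
  obtain ⟨t, ht⟩ := Submodule.mkQ_surjective _ (H.lift i hi v)
  exact ⟨t, hi, t.2, v.2, ht⟩

lemma IsLift.hasSolder {t : TangentSpace 𝓘(ℝ, E') p} {v : 𝔪} (h : H.IsLift i t v) :
    S.HasSolder i p t v := by
  obtain ⟨hi, h, hv, e⟩ := h
  refine ⟨h, ?_⟩
  have h1 : S.toSymbol i p ⟨t, h⟩ = (S.frame p).toEquiv i ⟨v, hv⟩ := by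
    rw [← H.twoToSymbol_lift i hi, ← e]
    rfl
  have h2 : S.solder i p ⟨t, h⟩ = ⟨v, hv⟩ := by
    rw [solder, LinearMap.comp_apply, h1]
    exact LinearEquiv.symm_apply_apply _ _
  rw [h2]

/-- The projection `pr^ℋ` computed on representatives. -/
lemma IsLift.hasSolder_pr {t u : TangentSpace 𝓘(ℝ, E') p} {v : 𝔪} (h : H.IsLift i t v)
    (hu : S.HasSolder i p u v) (hi : i < 0) (hu' : u ∈ S.filt i p) :
    S.HasSolder (i + 1) p (u - t)
      (S.solderBar (i + 1) p (H.pr i hi (S.mkTwo i p ⟨u, hu'⟩)) : 𝔤.piece (i + 1)) := by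
  have hd : u - t ∈ S.filt (i + 1) p := hu.sub_mem_filt hi h.hasSolder
  obtain ⟨_, ht, hv, e⟩ := h
  -- The decomposition of the class of `u` along `H^i`: the first summand is killed by `pr^ℋ`, the
  -- second is fixed.
  have h1 : S.mkTwo i p ⟨u, hu'⟩ = H.lift i hi ⟨v, hv⟩ +
      S.grIncl i p (Submodule.mkQ _ ⟨u - t, hd⟩) := by
    rw [← e]
    have : (⟨u, hu'⟩ : S.filt i p) =
        ⟨t, ht⟩ + Submodule.inclusion (S.filt_succ_le i p) ⟨u - t, hd⟩ :=
      Subtype.ext (add_sub_cancel t u).symm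
    rw [this, map_add]
    rfl
  have h2 : H.pr i hi (H.lift i hi ⟨v, hv⟩) = 0 :=
    LinearMap.linearProjOfIsCompl_apply_right' _ _ _ _ _ (Subtype.mem _)
  have h3 : ∀ z, H.pr i hi (S.grIncl i p z) = z := fun z =>
    LinearMap.linearProjOfIsCompl_apply_left ..
  rw [h1, map_add, h2, h3, zero_add]
  exact ⟨hd, rfl⟩

lemma gap_eq_mk {t t' : TangentSpace 𝓘(ℝ, E') p} {v : 𝔤.piece i} (hi : i < 0)
    (h : H.IsLift i t v) (h' : H'.IsLift i t' v) :
    ∃ hd : t' - t ∈ S.filt (i + 1) p, gap H H' i hi v = Submodule.mkQ _ ⟨t' - t, hd⟩ := by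
  have hd : t' - t ∈ S.filt (i + 1) p := h'.hasSolder.sub_mem_filt hi h.hasSolder
  refine ⟨hd, S.grIncl_injective i p ?_⟩
  obtain ⟨_, ht, hv, e⟩ := h
  obtain ⟨_, ht', hv', e'⟩ := h'
  rw [grIncl_gap]
  refine (congrArg₂ (· - ·) e'.symm e.symm).trans ?_
  rfl

/-- The value of `f_{ℋ ℋ'}` on `𝔤^{-1}`. -/
lemma exists_diffHom_eq_inDer {t t' : TangentSpace 𝓘(ℝ, E') p} {v : 𝔤.piece i} (hi : i < 0)
    (hi' : i + 1 = 0) (h : H.IsLift i t v) (h' : H'.IsLift i t' v) :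
    ∃ X : TangentSpace 𝓘(ℝ, F) (1 : G), t' - t = S.vert p X ∧
      (H.diffHom H' i hi v : ExtAlgebra 𝔪) = inDer (ρ.toDer X) := by
  obtain ⟨hd, e⟩ := gap_eq_mk hi h h'
  refine ⟨(S.vertEquiv p hi').symm (gap H H' i hi v), ?_, ?_⟩
  · have h1 := (S.vertEquiv p hi').apply_symm_apply (gap H H' i hi v)
    rw [e] at h1 ⊢
    set X := (S.vertEquiv p hi').symm (Submodule.mkQ _ ⟨t' - t, hd⟩)
    have h2 : S.vert p X - (t' - t) ∈ S.filt (i + 1 + 1) p :=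
      (Submodule.Quotient.eq ((S.filt (i + 1 + 1) p).submoduleOf (S.filt (i + 1) p))).1 h1
    -- Here `i + 2 = 1`, and `D₀^1 = 0` turns the congruence into an equality.
    rw [filt, if_neg (by omega), Submodule.mem_bot] at h2
    exact (sub_eq_zero.1 h2).symm
  · unfold diffHom
    rw [dif_pos hi']
    rfl

/-- The value of `f_{ℋ ℋ'}` on `𝔤^i`, `i < -1`. -/
lemma exists_diffHom_eq_inM {t t' : TangentSpace 𝓘(ℝ, E') p} {v : 𝔤.piece i} (hi : i < 0)
    (hi' : i + 1 ≠ 0) (h : H.IsLift i t v) (h' : H'.IsLift i t' v) :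
    ∃ m : 𝔪, S.HasSolder (i + 1) p (t' - t) m ∧
      (H.diffHom H' i hi v : ExtAlgebra 𝔪) = inM m := by
  obtain ⟨hd, e⟩ := gap_eq_mk hi h h'
  refine ⟨S.solderBar (i + 1) p (gap H H' i hi v), ⟨hd, ?_⟩, ?_⟩
  · rw [e]
    rfl
  · unfold diffHom
    rw [dif_neg hi']
    rfl

lemma diffHom_self (H : S.ComplTuple p) (hi : i < 0) (v : 𝔤.piece i) : H.diffHom H i hi v = 0 := by
  have h : gap H H i hi v = 0 := by
    apply S.grIncl_injective i p
    rw [grIncl_gap, sub_self, map_zero]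
  unfold diffHom
  split_ifs <;> exact Subtype.ext (by simp [h])

lemma spencer_diffHom_self (H : S.ComplTuple p) (hi : i < 0) (v₁ : 𝔤.piece (-1))
    (v₂ : 𝔤.piece i) : spencer ρ (H.diffHom H) i hi v₁ v₂ = 0 := by
  have h : ∀ (j : ℤ) (hj : j < 0) (v : 𝔤.piece j), (H.diffHom H j hj v : ExtAlgebra 𝔪) = 0 :=
    fun j hj v => congrArg Subtype.val (H.diffHom_self hj v)
  rw [spencer, h, h, h, zero_lie, lie_zero, add_zero, sub_zero]

end ComplTuple

end ConstantTypeStructure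

namespace ConstantTypeStructure

/-! ### Existence of adapted fields, the transformation rule, independence of choices -/

namespace ComplTuple

variable {𝔪 : Type*} [LieRing 𝔪] [LieAlgebra ℝ 𝔪] [FiniteDimensional ℝ 𝔪]
  {𝔤 : FundamentalGrading 𝔪}
  {E : Type*} [NormedAddCommGroup E] [NormedSpace ℝ E] [FiniteDimensional ℝ E]
  {M : Type*} [TopologicalSpace M] [ChartedSpace E M] [IsManifold 𝓘(ℝ, E) ∞ M]
  {D : ∀ x : M, Submodule ℝ (TangentSpace 𝓘(ℝ, E) x)}
  {F : Type*} [NormedAddCommGroup F] [NormedSpace ℝ F]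
  {G : Type*} [TopologicalSpace G] [ChartedSpace F G] [Group G] [LieGroup 𝓘(ℝ, F) ∞ G]
  {ρ : LieSubgroup 𝔤 F G}
  {E' : Type*} [NormedAddCommGroup E'] [NormedSpace ℝ E'] [FiniteDimensional ℝ E']
  {P : Type*} [TopologicalSpace P] [ChartedSpace E' P] [IsManifold 𝓘(ℝ, E') ∞ P]
  {S : ConstantTypeStructure D ρ E' P} {p : P} {H H' : S.ComplTuple p} {i : ℤ}

/-- `smooth_frame` gives a field `W` along the projection that represents `φ v` at all nearby
points, but at `p` it may differ from the projection of the required value `t` by an element of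
`D^{i+1}`. Adding a section `X` of `D^{i+1}` repairs this without changing the class, and the sum
lifts to a field with value `t`. -/
lemma exists_isAdapted (hD : IsRegularDistribution D) (H : S.ComplTuple p) (hi : i < 0)
    (v : 𝔤.piece i) : ∃ Y : ∀ q : P, TangentSpace 𝓘(ℝ, E') q, H.IsAdapted i hi v Y := by
  obtain ⟨t, ht⟩ := H.exists_isLift hi v
  obtain ⟨U, W, hU, hpU, hW, hWv⟩ : ∃ (U : Set P) (W : ∀ q : P, TangentSpace 𝓘(ℝ, E) (S.proj q)),
      IsOpen U ∧ p ∈ U ∧ ContMDiffOn 𝓘(ℝ, E') 𝓘(ℝ, E).tangent ∞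
        (fun q => (⟨S.proj q, W q⟩ : TangentBundle 𝓘(ℝ, E) M)) U ∧
      ∀ q ∈ U, ∃ h : W q ∈ flag D i (S.proj q),
        symbolMk D i (S.proj q) ⟨W q, h⟩ = (S.frame q).toEquiv i v := S.smooth_frame p i v hi
  obtain ⟨m, e⟩ := (hasSolder_iff hi.le).1 ht.hasSolder
  obtain ⟨n, f⟩ := hWv p hpU
  obtain ⟨X, ⟨U₁, hU₁, hxU₁, hXs, hXm⟩, hXx⟩ := exists_isLocalSection_flag hD
    ((symbolMk_eq_iff (x := S.proj p) m n).1 (e.trans f.symm))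
  have hproj := S.contMDiff_proj
  set O : Set P := (U ∩ S.proj ⁻¹' U₁) ∩ S.proj ⁻¹' (chartAt E (S.proj p)).source with hO
  have hOo : IsOpen O := (hU.inter (hU₁.preimage hproj.continuous)).inter
    ((chartAt E (S.proj p)).open_source.preimage hproj.continuous)
  have hpO : p ∈ O := ⟨⟨hpU, hxU₁⟩, mem_chart_source E (S.proj p)⟩
  have hsum : ContMDiffOn 𝓘(ℝ, E') 𝓘(ℝ, E).tangent ∞
      (fun q => (⟨S.proj q, W q + X (S.proj q)⟩ : TangentBundle 𝓘(ℝ, E) M)) O := by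
    have h1 := (contMDiffOn_along_iff hproj.contMDiffOn (fun q hq => hq.2) W).1
      (hW.mono fun q (hq : q ∈ O) => hq.1.1)
    have h2 := (contMDiffOn_along_iff hproj.contMDiffOn (fun q hq => hq.2)
      (fun q => X (S.proj q))).1
      (hXs.comp hproj.contMDiffOn fun q (hq : q ∈ O) => hq.1.2)
    refine (contMDiffOn_along_iff hproj.contMDiffOn (fun q hq => hq.2) _).2 ((h1.add h2).congr ?_)
    exact fun q _ => map_add (dchart E (S.proj p) (S.proj q)) _ _
  obtain ⟨Y, O', hO'o, hpO', hO'O, hYs, hYW, hYp⟩ := exists_lift_of_surjective hproj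
    (S.dproj_surjective p) hOo hpO hsum (u := t) (by
      rw [hXx]
      exact (add_sub_cancel (W p) (S.dproj p t)).symm)
  refine ⟨Y, ⟨O', hO'o, hpO', hYs, fun q hq => ?_⟩, ?_⟩
  · obtain ⟨h, e⟩ := hWv q (hO'O hq).1.1
    have hX := hXm _ (hO'O hq).1.2
    have hY : S.dproj q (Y q) = W q + X (S.proj q) := hYW q hq
    have hm : S.dproj q (Y q) ∈ flag D i (S.proj q) := by
      rw [hY]
      exact add_mem h (flag_succ_le D i _ hX)
    have h1 : S.HasSolder i q (Y q) v := by
      refine (hasSolder_iff hi.le).2 ⟨hm, Eq.trans ?_ e⟩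
      refine (symbolMk_eq_iff (x := S.proj q) hm h).2 ?_
      rw [hY, add_sub_cancel_left]
      exact hX
    obtain ⟨h2, h3⟩ := h1
    exact ⟨h2, Subtype.ext h3⟩
  · rw [hYp]
    obtain ⟨_, h, _, e⟩ := ht
    exact ⟨h, e⟩

lemma IsAdapted.isLift {hi : i < 0} {v : 𝔤.piece i} {Y : ∀ q : P, TangentSpace 𝓘(ℝ, E') q}
    (h : H.IsAdapted i hi v Y) : H.IsLift i (Y p) v := by
  obtain ⟨-, h, e⟩ := h
  exact ⟨hi, h, v.2, e⟩

lemma IsAdapted.eventually_hasSolder {hi : i < 0} {v : 𝔤.piece i}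
    {Y : ∀ q : P, TangentSpace 𝓘(ℝ, E') q} (h : H.IsAdapted i hi v Y) :
    ∀ᶠ q in 𝓝 p, S.HasSolder i q (Y q) v := by
  obtain ⟨⟨U, hU, hpU, -, hv⟩, -⟩ := h
  filter_upwards [hU.mem_nhds hpU] with q hq
  obtain ⟨h, e⟩ := hv q hq
  exact ⟨h, congrArg Subtype.val e⟩

lemma IsAdapted.isLocalSection {hi : i < 0} {v : 𝔤.piece i}
    {Y : ∀ q : P, TangentSpace 𝓘(ℝ, E') q} (h : H.IsAdapted i hi v Y) :
    IsLocalSection (S.filt i) Y p := by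
  obtain ⟨⟨U, hU, hpU, hs, hv⟩, -⟩ := h
  exact ⟨U, hU, hpU, hs, fun q hq => (hv q hq).1⟩

/-- The soldering values agree on a whole neighbourhood, not only at `p`. The values at `p` play no
role, so the two tuples may differ. -/
lemma IsAdapted.isLocalSection_sub {hi : i < 0} {v : 𝔤.piece i}
    {Y Y' : ∀ q : P, TangentSpace 𝓘(ℝ, E') q} (h : H.IsAdapted i hi v Y)
    (h' : H'.IsAdapted i hi v Y') : IsLocalSection (S.filt (i + 1)) (Y' - Y) p := by
  obtain ⟨U, hU, hpU, hs, -⟩ := h'.isLocalSection.sub h.isLocalSection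
  obtain ⟨U', hU', hUU', hpU'⟩ := eventually_nhds_iff.1
    (h.eventually_hasSolder.and h'.eventually_hasSolder)
  exact ⟨U ∩ U', hU.inter hUU', ⟨hpU, hpU'⟩, hs.mono Set.inter_subset_left,
    fun q hq => (hU' q hq.2).2.sub_mem_filt hi (hU' q hq.2).1⟩

lemma exists_isBracketTerm (hD : IsRegularDistribution D) {hi : i < 0} {v₁ : 𝔤.piece (-1)}
    {v₂ : 𝔤.piece i} {Y₁ Y₂ : ∀ q : P, TangentSpace 𝓘(ℝ, E') q}
    (h₁ : H.IsAdapted (-1) (by decide) v₁ Y₁) (h₂ : H.IsAdapted i hi v₂ Y₂) :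
    ∃ c, H.IsBracketTerm i hi Y₁ Y₂ c := by
  obtain ⟨h, -⟩ := HasSolder.mlieBracket hD hi h₁.isLocalSection h₂.isLocalSection
    h₁.isLift.hasSolder h₂.isLift.hasSolder
  rw [show -1 + i = i - 1 by ring] at h
  exact ⟨_, h, rfl⟩

/-- The bracket has soldering value `[v₁, v₂]` in degree `i - 1`, so `pr^ℋ` acts on it by
subtracting a representative `t` of `φ^ℋ([v₁, v₂])`. -/
lemma IsBracketTerm.hasSolder (hD : IsRegularDistribution D) {hi : i < 0} {v₁ : 𝔤.piece (-1)}
    {v₂ : 𝔤.piece i} {Y₁ Y₂ : ∀ q : P, TangentSpace 𝓘(ℝ, E') q}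
    (h₁ : H.IsAdapted (-1) (by decide) v₁ Y₁) (h₂ : H.IsAdapted i hi v₂ Y₂) {c : 𝔪}
    (hc : H.IsBracketTerm i hi Y₁ Y₂ c) {t : TangentSpace 𝓘(ℝ, E') p}
    (ht : H.IsLift (-1 + i) t ⁅(v₁ : 𝔪), (v₂ : 𝔪)⁆) :
    S.HasSolder i p (mlieBracket 𝓘(ℝ, E') Y₁ Y₂ p - t) c := by
  have h := HasSolder.mlieBracket hD hi h₁.isLocalSection h₂.isLocalSection
    h₁.isLift.hasSolder h₂.isLift.hasSolder
  rw [show -1 + i = i - 1 by ring] at h ht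
  obtain ⟨hb, hc⟩ := hc
  have h3 := ht.hasSolder_pr h (by omega) hb
  rw [← hc, show i - 1 + 1 = i by ring] at h3
  exact h3

/-- The transformation rule, for given choices of adapted vector fields. -/
lemma inM_isBracketTerm (hD : IsRegularDistribution D) {hi : i < 0} {v₁ : 𝔤.piece (-1)}
    {v₂ : 𝔤.piece i} {Y₁ Y₂ Y₁' Y₂' : ∀ q : P, TangentSpace 𝓘(ℝ, E') q}
    (h₁ : H.IsAdapted (-1) (by decide) v₁ Y₁) (h₂ : H.IsAdapted i hi v₂ Y₂)
    (h₁' : H'.IsAdapted (-1) (by decide) v₁ Y₁') (h₂' : H'.IsAdapted i hi v₂ Y₂') {c c' : 𝔪}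
    (hc : H.IsBracketTerm i hi Y₁ Y₂ c) (hc' : H'.IsBracketTerm i hi Y₁' Y₂' c') :
    inM c' = inM c + spencer ρ (H.diffHom H') i hi v₁ v₂ := by
  have : CompleteSpace E' := FiniteDimensional.complete ℝ E'
  set w : 𝔤.piece (-1 + i) := ⟨⁅(v₁ : 𝔪), (v₂ : 𝔪)⁆, 𝔤.lie_mem v₁.2 v₂.2⟩ with hw
  have hi' : -1 + i < 0 := by omega
  obtain ⟨t, ht⟩ := H.exists_isLift hi' w
  obtain ⟨t', ht'⟩ := H'.exists_isLift hi' w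
  -- The degree `-1 + i` is at most `-2`, so `f([v₁, v₂])` lies in `𝔪`, never in `𝔤^0`.
  obtain ⟨m, hm, em⟩ := exists_diffHom_eq_inM hi' (by omega) ht ht'
  rw [show -1 + i + 1 = i by ring] at hm
  obtain ⟨X, hX, eX⟩ := exists_diffHom_eq_inDer (by decide) (by decide) h₁.isLift h₁'.isLift
  have hZ₁ := h₁.isLocalSection_sub h₁'
  have hZ₂ := h₂.isLocalSection_sub h₂'
  have hvert : ∀ {Z : ∀ q : P, TangentSpace 𝓘(ℝ, E') q}, IsLocalSection (S.filt 0) Z p →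
      ∀ᶠ q in 𝓝 p, S.dproj q (Z q) = 0 := by
    intro Z hZ
    filter_upwards [hZ.eventually_mem] with q hq
    rw [mem_filt_iff le_rfl, flag_zero] at hq
    exact (Submodule.mem_bot ℝ).1 hq
  have s₁ : S.HasSolder i p (mlieBracket 𝓘(ℝ, E') (Y₁' - Y₁) Y₂' p) (ρ.toDer X v₂) :=
    HasSolder.mlieBracket_vert hi hZ₁.contMDiffAt h₂'.isLocalSection.contMDiffAt (hvert hZ₁) hX
      h₂'.eventually_hasSolder
  -- The term `[v₁, f v₂]`. For `i = -1` the field `Y₂' - Y₂` is vertical and the swapped bracket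
  -- yields the sign in `[v₁, X₂] = -X₂ v₁`; for `i < -1` the bracket of `𝔪` applies.
  obtain ⟨n, s₂, en⟩ : ∃ n : 𝔪, S.HasSolder i p (mlieBracket 𝓘(ℝ, E') Y₁ (Y₂' - Y₂) p) n ∧
      ⁅inM (v₁ : 𝔪), (H.diffHom H' i hi v₂ : ExtAlgebra 𝔪)⁆ = inM n := by
    by_cases hi0 : i + 1 = 0
    · obtain ⟨X₂, hX₂, eX₂⟩ := exists_diffHom_eq_inDer hi hi0 h₂.isLift h₂'.isLift
      refine ⟨-ρ.toDer X₂ v₁, ?_, by rw [eX₂, lie_inM_inDer, map_neg]⟩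
      rw [mlieBracket_swap_apply]
      rw [hi0] at hZ₂
      obtain rfl : i = -1 := by omega
      exact (HasSolder.mlieBracket_vert hi hZ₂.contMDiffAt h₁.isLocalSection.contMDiffAt
        (hvert hZ₂) hX₂ h₁.eventually_hasSolder).neg
    · obtain ⟨n, hn, en⟩ := exists_diffHom_eq_inM hi hi0 h₂.isLift h₂'.isLift
      refine ⟨⁅(v₁ : 𝔪), n⁆, ?_, by rw [en, lie_inM_inM]⟩
      have := HasSolder.mlieBracket hD (by omega) h₁.isLocalSection hZ₂ h₁.isLift.hasSolder hn
      rwa [show -1 + (i + 1) = i by ring] at this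
  have hb : mlieBracket 𝓘(ℝ, E') Y₁' Y₂' p = mlieBracket 𝓘(ℝ, E') Y₁ Y₂ p +
      mlieBracket 𝓘(ℝ, E') Y₁ (Y₂' - Y₂) p + mlieBracket 𝓘(ℝ, E') (Y₁' - Y₁) Y₂' p := by
    rw [← mlieBracket_add_right h₂.isLocalSection.mdifferentiableAt hZ₂.mdifferentiableAt,
      add_sub_cancel,
      ← mlieBracket_add_left h₁.isLocalSection.mdifferentiableAt hZ₁.mdifferentiableAt,
      add_sub_cancel]
  have k := hc.hasSolder hD h₁ h₂ ht
  have k' := hc'.hasSolder hD h₁' h₂' ht'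
  -- Both sides are soldering values of `[Y₁', Y₂'](λ) - t'`; replacing `t` by `t'` contributes
  -- `-m`.
  have hcc : c' = c + (ρ.toDer X v₂ + n - m) := by
    refine k'.unique ?_
    have := k.add ((s₁.add s₂).sub hm)
    convert this using 1
    rw [hb]
    abel
  rw [hcc, map_add, spencer, eX, lie_inDer_inM, en, em, map_sub, map_add]

lemma isBracketTerm_unique (hD : IsRegularDistribution D) {hi : i < 0} {v₁ : 𝔤.piece (-1)}
    {v₂ : 𝔤.piece i} {Y₁ Y₂ Y₁' Y₂' : ∀ q : P, TangentSpace 𝓘(ℝ, E') q}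
    (h₁ : H.IsAdapted (-1) (by decide) v₁ Y₁) (h₂ : H.IsAdapted i hi v₂ Y₂)
    (h₁' : H.IsAdapted (-1) (by decide) v₁ Y₁') (h₂' : H.IsAdapted i hi v₂ Y₂') {c c' : 𝔪}
    (hc : H.IsBracketTerm i hi Y₁ Y₂ c) (hc' : H.IsBracketTerm i hi Y₁' Y₂' c') : c' = c := by
  have h := inM_isBracketTerm hD h₁ h₂ h₁' h₂' hc hc'
  rw [spencer_diffHom_self, add_zero] at h
  exact congrArg (fun z : ExtAlgebra 𝔪 => z.left) h

/-- The value selected by choice comes from some adapted pair, and uniqueness carries it over to the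
given pair. The default `0` does not occur, because an adapted pair is at hand. -/
lemma isBracketTerm_structureFunction (hD : IsRegularDistribution D) {hi : i < 0}
    {v₁ : 𝔤.piece (-1)} {v₂ : 𝔤.piece i} {Y₁ Y₂ : ∀ q : P, TangentSpace 𝓘(ℝ, E') q}
    (h₁ : H.IsAdapted (-1) (by decide) v₁ Y₁) (h₂ : H.IsAdapted i hi v₂ Y₂) :
    H.IsBracketTerm i hi Y₁ Y₂ (H.structureFunction i hi v₁ v₂) := by
  obtain ⟨c, hc⟩ := exists_isBracketTerm hD h₁ h₂
  have h : ∃ c : 𝔪, ∃ Y₁ Y₂ : ∀ q : P, TangentSpace 𝓘(ℝ, E') q,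
      H.IsAdapted (-1) (by decide) v₁ Y₁ ∧ H.IsAdapted i hi v₂ Y₂ ∧ H.IsBracketTerm i hi Y₁ Y₂ c :=
    ⟨c, Y₁, Y₂, h₁, h₂, hc⟩
  obtain ⟨Z₁, Z₂, k₁, k₂, hk⟩ := h.choose_spec
  rw [structureFunction, dif_pos h, isBracketTerm_unique hD h₁ h₂ k₁ k₂ hc hk]
  exact hc

end ComplTuple

end ConstantTypeStructure

end Tanaka

end

/-! ### The proposition -/

theorem proposition1
    {𝔪 : Type*} [LieRing 𝔪] [LieAlgebra ℝ 𝔪] [FiniteDimensional ℝ 𝔪]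
    (𝔤 : Tanaka.FundamentalGrading 𝔪)
    {E : Type*} [NormedAddCommGroup E] [NormedSpace ℝ E] [FiniteDimensional ℝ E]
    {M : Type*} [TopologicalSpace M] [ChartedSpace E M] [IsManifold 𝓘(ℝ, E) ∞ M]
    (D : ∀ x : M, Submodule ℝ (TangentSpace 𝓘(ℝ, E) x))
    (hD : Tanaka.IsRegularDistribution D)
    {F : Type*} [NormedAddCommGroup F] [NormedSpace ℝ F] [FiniteDimensional ℝ F]
    {G : Type*} [TopologicalSpace G] [ChartedSpace F G] [Group G] [LieGroup 𝓘(ℝ, F) ∞ G]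
    (ρ : Tanaka.LieSubgroup 𝔤 F G)
    {E' : Type*} [NormedAddCommGroup E'] [NormedSpace ℝ E'] [FiniteDimensional ℝ E']
    {P : Type*} [TopologicalSpace P] [ChartedSpace E' P] [IsManifold 𝓘(ℝ, E') ∞ P]
    (S : Tanaka.ConstantTypeStructure D ρ E' P) (p : P) :
    -- the structure function of every tuple is well defined
    (∀ (H : S.ComplTuple p) (i : ℤ) (hi : i < 0) (v₁ : 𝔤.piece (-1)) (v₂ : 𝔤.piece i),
      (∃ Y₁ Y₂ : ∀ q : P, TangentSpace 𝓘(ℝ, E') q,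
        H.IsAdapted (-1) (by decide) v₁ Y₁ ∧ H.IsAdapted i hi v₂ Y₂) ∧
      ∀ Y₁ Y₂ : ∀ q : P, TangentSpace 𝓘(ℝ, E') q,
        H.IsAdapted (-1) (by decide) v₁ Y₁ → H.IsAdapted i hi v₂ Y₂ →
          H.IsBracketTerm i hi Y₁ Y₂ (H.structureFunction i hi v₁ v₂)) ∧
    -- the transformation rule
    ∀ (H H' : S.ComplTuple p) (i : ℤ) (hi : i < 0) (v₁ : 𝔤.piece (-1)) (v₂ : 𝔤.piece i),
      Tanaka.inM (H'.structureFunction i hi v₁ v₂) =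
        Tanaka.inM (H.structureFunction i hi v₁ v₂) +
          Tanaka.spencer ρ (H.diffHom H') i hi v₁ v₂ := by
  refine ⟨fun H i hi v₁ v₂ => ⟨?_, fun Y₁ Y₂ h₁ h₂ => H.isBracketTerm_structureFunction hD h₁ h₂⟩,
    fun H H' i hi v₁ v₂ => ?_⟩
  · obtain ⟨Y₁, h₁⟩ := H.exists_isAdapted hD (by decide) v₁
    obtain ⟨Y₂, h₂⟩ := H.exists_isAdapted hD hi v₂
    exact ⟨Y₁, Y₂, h₁, h₂⟩
  · obtain ⟨Y₁, h₁⟩ := H.exists_isAdapted hD (by decide) v₁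
    obtain ⟨Y₂, h₂⟩ := H.exists_isAdapted hD hi v₂
    obtain ⟨Y₁', h₁'⟩ := H'.exists_isAdapted hD (by decide) v₁
    obtain ⟨Y₂', h₂'⟩ := H'.exists_isAdapted hD hi v₂
    exact Tanaka.ConstantTypeStructure.ComplTuple.inM_isBracketTerm hD h₁ h₂ h₁' h₂'
      (H.isBracketTerm_structureFunction hD h₁ h₂) (H'.isBracketTerm_structureFunction hD h₁' h₂')
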